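/- Let $n\in\mathbb{N}$, $0<\alpha<\infty$, $1<s\le n/\alpha$, and let $$\mathrm{Cap}_{\alpha,s}(E)=\inf\{\|h\|_{L^s(\mathbb{R}^n)}^s : h\ge 0,\ G_\alpha*h\ge 1\text{ on }E\},\qquad E\subseteq\mathbb{R}^n,$$ be the Bessel capacity, where $G_\alpha=\mathcal{F}^{-1}[(1+|\cdot|^2)^{-\alpha/2}]$ is the Bessel kernel, with $\mathcal{F}g(\xi)=\int_{\mathbb{R}^n} e^{-i\xi\cdot x}g(x)\,dx$. Functions are measurable on $\mathbb{R}^n$, real-valued almost everywhere, and identified when equal almost everywhere. For $0<r,q<\infty$ put $\|f\|_{L^{r,q}}=r^{1/q}\big(\int_0^\infty |\{|f|>t\}|^{q/r}\,t^{q}\,\frac{dt}{t}\big)^{1/q}$ and $\|f\|_{L^{r,\infty}}=\sup_{t>0}t\,|\{|f|>t\}|^{1/r}$. For $1<p<\infty$ let $p'=p/(p-1)$. The weak Sobolev multiplier space $\mathcal{M}^{p,\infty}$ consists of all $f$ with $$\|f\|_{\mathcal{M}^{p,\infty}}=\sup_K\frac{\|f\chi_K\|_{L^{p,\infty}}}{\mathrm{Cap}_{\alpha,s}(K)^{1/p}}<\infty,$$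 the supremum being over all compact $K\subseteq\mathbb{R}^n$ with $\mathrm{Cap}_{\alpha,s}(K)\ne 0$. For $0<q\le 1$, a $\mathcal{B}^{p',q}$ block is a function $b$ for which there is a bounded set $E\supseteq\{b\neq 0\}$ with $\mathrm{Cap}_{\alpha,s}(E)^{1/p}\,\|b\|_{L^{p',q}}\le 1$. The block space $\mathcal{B}^{p',q}$ is the set of all $g=\sum_k\lambda_k b_k$ (convergence pointwise almost everywhere) with $(\lambda_k)\in\ell^1$ and $b_k$ blocks, with $\|g\|_{\mathcal{B}^{p',q}}=\inf\sum_k|\lambda_k|$, the infimum being over all such decompositions of $g$; $(\mathcal{B}^{p',q})^*$ is the space of its continuous linear functionals, with the operator norm. **Theorem (weak dual).** Let $1<p<\infty$ and $0<q\le 1$. Then $(\mathcal{B}^{p',q})^{*}\approx\mathcal{M}^{p,\infty}$; that is, there is a constant $c>0$ such that: 1. for every $L\in(\mathcal{B}^{p',q})^*$ there is a unique $f\in\mathcal{M}^{p,\infty}$ such that, for all $g\in\mathcal{B}^{p',q}$, $fg$ is integrable and $L(g)=\int_{\mathbb{R}^n} f(x)g(x)\,dx$; 2. for every $f\in\mathcal{M}^{p,\infty}$,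 $fg$ is integrable for every $g\in\mathcal{B}^{p',q}$ and $g\mapsto\int_{\mathbb{R}^n} fg\,dx$ is a continuous linear functional on $\mathcal{B}^{p',q}$; 3. whenever $L\in(\mathcal{B}^{p',q})^*$ and $f\in\mathcal{M}^{p,\infty}$ correspond in this way, $c^{-1}\|f\|_{\mathcal{M}^{p,\infty}}\le\|L\|\le c\,\|f\|_{\mathcal{M}^{p,\infty}}$. -/

import Mathlib

open MeasureTheory Filter Topology
open scoped ENNReal NNReal

noncomputable section

namespace SobolevMultiplier

/-- `ℝⁿ` with the Euclidean norm and Lebesgue measure `volume`. -/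
abbrev Rn (n : ℕ) : Type := EuclideanSpace ℝ (Fin n)

/-! ### Bessel kernels and Bessel capacities -/

/-- The integrand (in the variable `t`) of the Bessel kernel: the Gamma density
`t ^ (α / 2 - 1) e ^ (-t) / Γ(α / 2)` times the heat kernel
`(4 π t) ^ (-n / 2) e ^ (-|x|² / (4 t))`. -/
def besselIntegrand (n : ℕ) (α : ℝ) (t : ℝ) (x : Rn n) : ℝ :=
  (t ^ (α / 2 - 1) * Real.exp (-t) / Real.Gamma (α / 2)) *
    ((4 * Real.pi * t) ^ (-(n : ℝ) / 2) * Real.exp (-‖x‖ ^ 2 / (4 * t)))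

/-- The Bessel kernel `G_α` on `ℝⁿ`, as the everywhere defined `[0, ∞]`-valued function
`G_α(x) = Γ(α/2)⁻¹ ∫₀^∞ t ^ (α/2 - 1) e ^ (-t) (4 π t) ^ (-n/2) e ^ (-|x|² / (4 t)) dt`.
That this is the inverse Fourier transform of `(1 + |ξ|²) ^ (-α/2)` is proved below in
`integrable_besselKernel` and `fourier_besselKernel`. -/
def besselKernel (n : ℕ) (α : ℝ) (x : Rn n) : ℝ≥0∞ :=
  ∫⁻ t in Set.Ioi (0 : ℝ), ENNReal.ofReal (besselIntegrand n α t x)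

theorem measurable_besselIntegrand (n : ℕ) (α : ℝ) :
    Measurable (fun z : ℝ × Rn n => besselIntegrand n α z.1 z.2) := by
  unfold besselIntegrand
  fun_prop

theorem besselIntegrand_nonneg {n : ℕ} {α t : ℝ} (hα : 0 < α) (ht : 0 < t) (x : Rn n) :
    0 ≤ besselIntegrand n α t x := by
  have := Real.Gamma_pos_of_pos (half_pos hα)
  unfold besselIntegrand
  positivity

theorem integral_besselIntegrand_cexp {n : ℕ} {α t : ℝ} (ht : 0 < t) (ξ : Rn n) :
    ∫ x : Rn n, Complex.exp (-Complex.I * (inner ℝ ξ x : ℝ)) * (besselIntegrand n α t x : ℂ) =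
      ((t ^ (α / 2 - 1) * Real.exp (-((1 + ‖ξ‖ ^ 2) * t)) / Real.Gamma (α / 2) : ℝ) : ℂ) := by
  have hb : 0 < ((1 / (4 * t) : ℝ) : ℂ).re := by
    rw [Complex.ofReal_re]; positivity
  have key := GaussianFourier.integral_cexp_neg_mul_sq_norm_add hb (-Complex.I) ξ
  have h1 : ∀ x : Rn n,
      Complex.exp (-Complex.I * (inner ℝ ξ x : ℝ)) * (besselIntegrand n α t x : ℂ) =
        ((t ^ (α / 2 - 1) * Real.exp (-t) / Real.Gamma (α / 2) *
          (4 * Real.pi * t) ^ (-(n : ℝ) / 2) : ℝ) : ℂ) *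
          Complex.exp (-((1 / (4 * t) : ℝ) : ℂ) * (‖x‖ : ℂ) ^ 2 +
            -Complex.I * (inner ℝ ξ x : ℝ)) := by
    intro x
    have h2 : -‖x‖ ^ 2 / (4 * t) = -(1 / (4 * t)) * ‖x‖ ^ 2 := by ring
    rw [Complex.exp_add, besselIntegrand, h2]
    push_cast
    ring
  simp_rw [h1]
  rw [integral_const_mul, key]
  have h3 : ((Real.pi : ℂ) / ((1 / (4 * t) : ℝ) : ℂ)) ^ ((Module.finrank ℝ (Rn n) : ℂ) / 2) =
      (((4 * Real.pi * t) ^ ((n : ℝ) / 2) : ℝ) : ℂ) := by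
    rw [Complex.ofReal_cpow (by positivity), finrank_euclideanSpace, Fintype.card_fin]
    have : (Real.pi : ℂ) / ((1 / (4 * t) : ℝ) : ℂ) = ((4 * Real.pi * t : ℝ) : ℂ) := by
      push_cast
      field_simp
    rw [this]
    push_cast
    rfl
  have h4 : (-Complex.I) ^ 2 * (‖ξ‖ : ℂ) ^ 2 / (4 * ((1 / (4 * t) : ℝ) : ℂ)) =
      ((-(‖ξ‖ ^ 2 * t) : ℝ) : ℂ) := by
    have : (t : ℂ) ≠ 0 := by exact_mod_cast ht.ne'
    rw [neg_sq, Complex.I_sq]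
    push_cast
    field_simp
  rw [h3, h4, ← Complex.ofReal_exp, ← Complex.ofReal_mul, ← Complex.ofReal_mul]
  congr 1
  have h5 : (4 * Real.pi * t) ^ (-(n : ℝ) / 2) * (4 * Real.pi * t) ^ ((n : ℝ) / 2) = 1 := by
    rw [← Real.rpow_add (by positivity)]
    ring_nf
    simp
  have h6 : Real.exp (-((1 + ‖ξ‖ ^ 2) * t)) = Real.exp (-t) * Real.exp (-(‖ξ‖ ^ 2 * t)) := by
    rw [← Real.exp_add]; ring_nf
  rw [h6]
  linear_combination (t ^ (α / 2 - 1) * Real.exp (-t) / Real.Gamma (α / 2) *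
    Real.exp (-(‖ξ‖ ^ 2 * t))) * h5

theorem integral_gamma_density {α r : ℝ} (hα : 0 < α) (hr : 0 < r) :
    ∫ t in Set.Ioi (0 : ℝ), t ^ (α / 2 - 1) * Real.exp (-(r * t)) / Real.Gamma (α / 2) =
      r ^ (-α / 2) := by
  have h := Real.integral_rpow_mul_exp_neg_mul_Ioi (half_pos hα) hr
  have hG := (Real.Gamma_pos_of_pos (half_pos hα)).ne'
  rw [integral_div, h, mul_div_assoc, div_self hG, mul_one, one_div, Real.inv_rpow hr.le,
    ← Real.rpow_neg hr.le, neg_div]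

theorem lintegral_besselIntegrand {n : ℕ} {α t : ℝ} (hα : 0 < α) (ht : 0 < t) :
    ∫⁻ x : Rn n, ENNReal.ofReal (besselIntegrand n α t x) =
      ENNReal.ofReal (t ^ (α / 2 - 1) * Real.exp (-(1 * t)) / Real.Gamma (α / 2)) := by
  have h0 := integral_besselIntegrand_cexp (n := n) (α := α) ht 0
  simp only [inner_zero_left, Complex.ofReal_zero, mul_zero, Complex.exp_zero, one_mul,
    norm_zero, ne_eq, OfNat.ofNat_ne_zero, not_false_eq_true, zero_pow, add_zero] at h0
  rw [integral_complex_ofReal, Complex.ofReal_inj] at h0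
  have hpos : 0 < t ^ (α / 2 - 1) * Real.exp (-t) / Real.Gamma (α / 2) := by
    have := Real.Gamma_pos_of_pos (half_pos hα)
    positivity
  have hint : Integrable (fun x : Rn n => besselIntegrand n α t x) :=
    Integrable.of_integral_ne_zero (by rw [h0]; exact hpos.ne')
  rw [← ofReal_integral_eq_lintegral_ofReal hint
    (Eventually.of_forall fun x => besselIntegrand_nonneg hα ht x), h0, one_mul]

theorem measurable_besselKernel (n : ℕ) (α : ℝ) : Measurable (besselKernel n α) :=
  Measurable.lintegral_prod_left'
    (f := fun z : ℝ × Rn n => ENNReal.ofReal (besselIntegrand n α z.1 z.2))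
    (measurable_besselIntegrand n α).ennreal_ofReal

theorem lintegral_besselKernel (n : ℕ) {α : ℝ} (hα : 0 < α) : ∫⁻ x, besselKernel n α x = 1 := by
  unfold besselKernel
  rw [lintegral_lintegral_swap
    (((measurable_besselIntegrand n α).comp measurable_swap).ennreal_ofReal.aemeasurable)]
  rw [setLIntegral_congr_fun measurableSet_Ioi
    (fun t ht => lintegral_besselIntegrand (n := n) hα ht)]
  have h1 := integral_gamma_density hα one_pos
  rw [Real.one_rpow] at h1
  rw [← ofReal_integral_eq_lintegral_ofReal
    (Integrable.of_integral_ne_zero (by rw [h1]; exact one_ne_zero)), h1, ENNReal.ofReal_one]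
  filter_upwards [ae_restrict_mem measurableSet_Ioi] with t ht
  have := Real.Gamma_pos_of_pos (half_pos hα)
  have ht' : 0 < t := ht
  simp only [Pi.zero_apply]
  positivity

/-- The Bessel kernel is integrable on `ℝⁿ`. -/
theorem integrable_besselKernel (n : ℕ) {α : ℝ} (hα : 0 < α) :
    Integrable (fun x => (besselKernel n α x).toReal) :=
  integrable_toReal_of_lintegral_ne_top (measurable_besselKernel n α).aemeasurable
    (by rw [lintegral_besselKernel n hα]; exact ENNReal.one_ne_top)

/-- The Fourier transform `ξ ↦ ∫ e ^ (-i ξ·x) G_α(x) dx` of the Bessel kernel is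
`(1 + |ξ|²) ^ (-α/2)`. -/
theorem fourier_besselKernel (n : ℕ) {α : ℝ} (hα : 0 < α) (ξ : Rn n) :
    ∫ x : Rn n, Complex.exp (-Complex.I * (inner ℝ ξ x : ℝ)) * ((besselKernel n α x).toReal : ℂ) =
      (((1 + ‖ξ‖ ^ 2) ^ (-α / 2) : ℝ) : ℂ) := by
  have hm := measurable_besselIntegrand n α
  have h1 : ∀ x : Rn n, (besselKernel n α x).toReal =
      ∫ t in Set.Ioi (0 : ℝ), besselIntegrand n α t x := fun x => by
    rw [integral_eq_lintegral_of_nonneg_ae]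
    · rfl
    · filter_upwards [ae_restrict_mem measurableSet_Ioi] with t ht
      exact besselIntegrand_nonneg hα ht x
    · exact (hm.comp (measurable_id.prodMk measurable_const)).aestronglyMeasurable
  have h2 : Integrable (Function.uncurry fun (x : Rn n) (t : ℝ) =>
      Complex.exp (-Complex.I * (inner ℝ ξ x : ℝ)) * (besselIntegrand n α t x : ℂ))
      (volume.prod (volume.restrict (Set.Ioi 0))) := by
    have hm1 : Measurable (fun z : Rn n × ℝ => besselIntegrand n α z.2 z.1) :=
      hm.comp measurable_swap
    refine ⟨?_, ?_⟩
    · refine Measurable.aestronglyMeasurable ?_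
      unfold Function.uncurry
      refine Measurable.mul ?_ (Complex.measurable_ofReal.comp hm1)
      fun_prop
    · unfold HasFiniteIntegral
      have h3 : ∀ z : Rn n × ℝ, ‖Function.uncurry (fun (x : Rn n) (t : ℝ) =>
          Complex.exp (-Complex.I * (inner ℝ ξ x : ℝ)) * (besselIntegrand n α t x : ℂ)) z‖ₑ =
          ‖besselIntegrand n α z.2 z.1‖ₑ := fun z => by
        have : ‖Complex.exp (-Complex.I * (inner ℝ ξ z.1 : ℝ))‖ₑ = 1 := by
          rw [← ofReal_norm, Complex.norm_exp]
          simp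
        simp only [Function.uncurry, enorm_mul, this, one_mul]
        rw [← ofReal_norm, Complex.norm_real, ofReal_norm]
      simp_rw [h3]
      rw [lintegral_prod _ hm1.enorm.aemeasurable]
      have h4 : ∀ x : Rn n, ∫⁻ t in Set.Ioi (0 : ℝ), ‖besselIntegrand n α t x‖ₑ =
          besselKernel n α x := fun x =>
        setLIntegral_congr_fun measurableSet_Ioi fun t ht =>
          Real.enorm_of_nonneg (besselIntegrand_nonneg hα ht x)
      simp_rw [h4]
      rw [lintegral_besselKernel n hα]
      exact ENNReal.one_lt_top
  simp_rw [h1, ← integral_complex_ofReal, ← integral_const_mul]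
  rw [integral_integral_swap h2, setIntegral_congr_fun measurableSet_Ioi
    (fun t ht => integral_besselIntegrand_cexp (n := n) (α := α) ht ξ), integral_complex_ofReal,
    integral_gamma_density hα (by positivity)]

/-- The convolution `G_α * f` of the Bessel kernel with a nonnegative function. -/
def besselConv (n : ℕ) (α : ℝ) (f : Rn n → ℝ≥0∞) (x : Rn n) : ℝ≥0∞ :=
  ∫⁻ y, besselKernel n α (x - y) * f y

/-- The Bessel capacity
`Cap_{α,s}(E) = inf {‖f‖_{L^s}^s : f ≥ 0, G_α * f ≥ 1 on E}` of an arbitrary set `E`. -/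
def besselCap (n : ℕ) (α s : ℝ) (E : Set (Rn n)) : ℝ≥0∞ :=
  ⨅ (f : Rn n → ℝ≥0∞) (_ : Measurable f) (_ : ∀ x ∈ E, 1 ≤ besselConv n α f x),
    ∫⁻ x, f x ^ s

/-! ### Lorentz quasi-norms -/

/-- The Lorentz quasi-norm
`‖f‖_{L^{p,q}} = p ^ (1/q) (∫₀^∞ |{|f| > t}| ^ (q/p) t ^ q dt/t) ^ (1/q)`, for `0 < p, q < ∞`. -/
def lorentzNorm {n : ℕ} (p q : ℝ) (f : Rn n → ℝ) : ℝ≥0∞ :=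
  ENNReal.ofReal p ^ (1 / q) *
    (∫⁻ t in Set.Ioi (0 : ℝ),
      volume {x | t < |f x|} ^ (q / p) * ENNReal.ofReal (t ^ q / t)) ^ (1 / q)

/-- The weak Lebesgue quasi-norm `‖f‖_{L^{p,∞}} = sup_{t > 0} t |{|f| > t}| ^ (1/p)`. -/
def weakLorentzNorm {n : ℕ} (p : ℝ) (f : Rn n → ℝ) : ℝ≥0∞ :=
  ⨆ (t : ℝ) (_ : 0 < t), ENNReal.ofReal t * volume {x | t < |f x|} ^ (1 / p)

/-! ### The weak Sobolev multiplier space `𝓜^{p,∞}` -/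

/-- `‖f‖_{𝓜^{p,∞}} = sup_K ‖f χ_K‖_{L^{p,∞}} / Cap_{α,s}(K) ^ (1/p)`, the supremum being taken over
the compact sets `K` of nonzero capacity. -/
def weakMultiplierNorm (n : ℕ) (α s p : ℝ) (f : Rn n → ℝ) : ℝ≥0∞ :=
  ⨆ (K : Set (Rn n)) (_ : IsCompact K) (_ : besselCap n α s K ≠ 0),
    weakLorentzNorm p (K.indicator f) / besselCap n α s K ^ (1 / p)

/-- The space `𝓜^{p,∞}` of (classes modulo a.e. equality of) measurable functions with finite
`‖f‖_{𝓜^{p,∞}}`. -/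
def weakMultiplierSpace (n : ℕ) (α s p : ℝ) : Set (Rn n →ₘ[volume] ℝ) :=
  {f | weakMultiplierNorm n α s p f < ∞}

/-! ### The block space `𝓑^{p,q}` -/

/-- A `𝓑^{p,q}` block: a measurable `b` vanishing outside some bounded set `E` for which
`Cap_{α,s}(E) ^ (1/p') ‖b‖_{L^{p,q}} ≤ 1`, where `p' = p / (p - 1)`. -/
def IsBlock (n : ℕ) (α s p q : ℝ) (b : Rn n → ℝ) : Prop :=
  AEMeasurable b volume ∧
    ∃ E : Set (Rn n), Bornology.IsBounded E ∧ {x | b x ≠ 0} ⊆ E ∧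
      besselCap n α s E ^ (1 / Real.conjExponent p) * lorentzNorm p q b ≤ 1

/-- `f = ∑ₖ cₖ bₖ` is a block decomposition: `(cₖ) ∈ ℓ¹`, the `bₖ` are blocks, and the series
converges to `f` pointwise almost everywhere. Terms with `cₖ = 0` count as absent (so finite sums
are included), and nothing is asked of `bₖ` for them. -/
structure IsBlockDecomposition (n : ℕ) (α s p q : ℝ) (f : Rn n →ₘ[volume] ℝ)
    (c : ℕ → ℝ) (b : ℕ → Rn n → ℝ) : Prop where
  summable : Summable fun k => |c k|
  isBlock : ∀ k, c k ≠ 0 → IsBlock n α s p q (b k)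
  tendsto : ∀ᵐ x, Tendsto (fun N => ∑ k ∈ Finset.range N, c k * b k x) atTop (𝓝 (f x))

/-- Two sequences interleaved: `u 0, v 0, u 1, v 1, …`. -/
def interleave {X : Type*} (u v : ℕ → X) (k : ℕ) : X :=
  if k % 2 = 0 then u (k / 2) else v (k / 2)

theorem interleave_even {X : Type*} (u v : ℕ → X) (k : ℕ) : interleave u v (2 * k) = u k := by
  simp [interleave]

theorem interleave_odd {X : Type*} (u v : ℕ → X) (k : ℕ) :
    interleave u v (2 * k + 1) = v k := by
  have h : (2 * k + 1) / 2 = k := by omega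
  simp [interleave, h]

theorem sum_interleave (u v : ℕ → ℝ) (N : ℕ) :
    ∑ k ∈ Finset.range (2 * N), interleave u v k =
      ∑ k ∈ Finset.range N, u k + ∑ k ∈ Finset.range N, v k := by
  induction N with
  | zero => simp
  | succ N ih =>
    rw [show 2 * (N + 1) = 2 * N + 1 + 1 by ring, Finset.sum_range_succ, Finset.sum_range_succ, ih,
      interleave_even, interleave_odd, Finset.sum_range_succ, Finset.sum_range_succ]
    ring

theorem tendsto_sum_interleave {u v : ℕ → ℝ} {a b : ℝ}
    (hu : Tendsto (fun N => ∑ k ∈ Finset.range N, u k) atTop (𝓝 a))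
    (hv : Tendsto (fun N => ∑ k ∈ Finset.range N, v k) atTop (𝓝 b)) :
    Tendsto (fun N => ∑ k ∈ Finset.range N, interleave u v k) atTop (𝓝 (a + b)) := by
  have h2 : Tendsto (fun N : ℕ => N / 2) atTop atTop :=
    Nat.tendsto_div_const_atTop (by norm_num)
  have h3 : Tendsto (fun N : ℕ => (N + 1) / 2) atTop atTop :=
    h2.comp (tendsto_add_atTop_nat 1)
  refine ((hu.comp h3).add (hv.comp h2)).congr fun N => ?_
  simp only [Function.comp]
  rcases Nat.even_or_odd' N with ⟨m, rfl | rfl⟩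
  · rw [sum_interleave, show (2 * m + 1) / 2 = m by omega, show 2 * m / 2 = m by omega]
  · rw [Finset.sum_range_succ, sum_interleave, interleave_even,
      show (2 * m + 1 + 1) / 2 = m + 1 by omega, show (2 * m + 1) / 2 = m by omega,
      Finset.sum_range_succ]
    ring

theorem hasSum_interleave {u v : ℕ → ℝ} {a b : ℝ} (hu : HasSum u a) (hv : HasSum v b) :
    HasSum (interleave u v) (a + b) :=
  HasSum.even_add_odd (by simpa only [interleave_even] using hu)
    (by simpa only [interleave_odd] using hv)

theorem apply_interleave {X Y : Type*} (F : X → Y) (u v : ℕ → X) :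
    (fun k => F (interleave u v k)) = interleave (fun k => F (u k)) (fun k => F (v k)) := by
  funext k
  unfold interleave
  split_ifs <;> rfl

theorem IsBlockDecomposition.zero (n : ℕ) (α s p q : ℝ) :
    IsBlockDecomposition n α s p q 0 (fun _ => 0) (fun _ _ => 0) where
  summable := by simp
  isBlock := fun _ h => (h rfl).elim
  tendsto := by
    filter_upwards [AEEqFun.coeFn_zero (α := Rn n) (β := ℝ) (μ := volume)] with x hx
    simp [hx]

theorem IsBlockDecomposition.add {n : ℕ} {α s p q : ℝ} {f g : Rn n →ₘ[volume] ℝ}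
    {c d : ℕ → ℝ} {b e : ℕ → Rn n → ℝ} (hf : IsBlockDecomposition n α s p q f c b)
    (hg : IsBlockDecomposition n α s p q g d e) :
    IsBlockDecomposition n α s p q (f + g) (interleave c d) (interleave b e) where
  summable := by
    rw [apply_interleave (fun x : ℝ => |x|)]
    exact (hasSum_interleave hf.summable.hasSum hg.summable.hasSum).summable
  isBlock := fun k hk => by
    unfold interleave at hk ⊢
    split_ifs at hk ⊢
    · exact hf.isBlock _ hk
    · exact hg.isBlock _ hk
  tendsto := by
    filter_upwards [hf.tendsto, hg.tendsto, AEEqFun.coeFn_add f g] with x h1 h2 h3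
    rw [h3, Pi.add_apply]
    refine (tendsto_sum_interleave h1 h2).congr fun N => Finset.sum_congr rfl fun k _ => ?_
    unfold interleave
    split_ifs <;> rfl

theorem IsBlockDecomposition.smul {n : ℕ} {α s p q : ℝ} {f : Rn n →ₘ[volume] ℝ}
    {c : ℕ → ℝ} {b : ℕ → Rn n → ℝ} (hf : IsBlockDecomposition n α s p q f c b) (a : ℝ) :
    IsBlockDecomposition n α s p q (a • f) (fun k => a * c k) b where
  summable := by simpa only [abs_mul] using hf.summable.mul_left |a|
  isBlock := fun k hk => hf.isBlock k (right_ne_zero_of_mul hk)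
  tendsto := by
    filter_upwards [hf.tendsto, AEEqFun.coeFn_smul a f] with x h1 h2
    rw [h2, Pi.smul_apply, smul_eq_mul]
    simpa only [Finset.mul_sum, mul_assoc] using h1.const_mul a

/-- The vector space underlying `𝓑^{p,q}`: all (classes of) functions that have a block
decomposition. -/
def blockSubmodule (n : ℕ) (α s p q : ℝ) : Submodule ℝ (Rn n →ₘ[volume] ℝ) where
  carrier := {f | ∃ c b, IsBlockDecomposition n α s p q f c b}
  zero_mem' := ⟨_, _, IsBlockDecomposition.zero n α s p q⟩
  add_mem' := by
    rintro f g ⟨c, b, hf⟩ ⟨d, e, hg⟩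
    exact ⟨_, _, hf.add hg⟩
  smul_mem' := by
    rintro a f ⟨c, b, hf⟩
    exact ⟨_, _, hf.smul a⟩

/-- The values `∑ₖ |cₖ|` over all block decompositions of `f`. -/
def blockSums (n : ℕ) (α s p q : ℝ) (f : Rn n →ₘ[volume] ℝ) : Set ℝ :=
  {r | ∃ c b, IsBlockDecomposition n α s p q f c b ∧ r = ∑' k, |c k|}

/-- `‖f‖_{𝓑^{p,q}} = inf {∑ₖ |cₖ| : f = ∑ₖ cₖ bₖ}`, for `f` in `𝓑^{p,q}`. -/
def blockNorm (n : ℕ) (α s p q : ℝ) (f : Rn n →ₘ[volume] ℝ) : ℝ :=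
  sInf (blockSums n α s p q f)

theorem blockSums_bddBelow (n : ℕ) (α s p q : ℝ) (f : Rn n →ₘ[volume] ℝ) :
    BddBelow (blockSums n α s p q f) :=
  ⟨0, by rintro r ⟨c, b, -, rfl⟩; exact tsum_nonneg fun k => abs_nonneg _⟩

theorem blockNorm_nonneg (n : ℕ) (α s p q : ℝ) (f : Rn n →ₘ[volume] ℝ) :
    0 ≤ blockNorm n α s p q f :=
  Real.sInf_nonneg (by rintro r ⟨c, b, -, rfl⟩; exact tsum_nonneg fun k => abs_nonneg _)

theorem blockNorm_zero (n : ℕ) (α s p q : ℝ) : blockNorm n α s p q 0 = 0 :=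
  le_antisymm
    (csInf_le (blockSums_bddBelow n α s p q 0)
      ⟨_, _, IsBlockDecomposition.zero n α s p q, by simp⟩)
    (blockNorm_nonneg n α s p q 0)

theorem blockNorm_add_le {n : ℕ} {α s p q : ℝ} {f g : Rn n →ₘ[volume] ℝ}
    (hf : f ∈ blockSubmodule n α s p q) (hg : g ∈ blockSubmodule n α s p q) :
    blockNorm n α s p q (f + g) ≤ blockNorm n α s p q f + blockNorm n α s p q g := by
  obtain ⟨c₀, b₀, h₀⟩ := hf
  obtain ⟨d₀, e₀, k₀⟩ := hg
  have key : ∀ r ∈ blockSums n α s p q f, ∀ r' ∈ blockSums n α s p q g,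
      blockNorm n α s p q (f + g) ≤ r + r' := by
    rintro _ ⟨c, b, h, rfl⟩ _ ⟨d, e, k, rfl⟩
    refine csInf_le (blockSums_bddBelow n α s p q _) ⟨_, _, h.add k, ?_⟩
    rw [apply_interleave (fun x : ℝ => |x|)]
    exact (hasSum_interleave h.summable.hasSum k.summable.hasSum).tsum_eq.symm
  have h1 : ∀ r ∈ blockSums n α s p q f,
      blockNorm n α s p q (f + g) - r ≤ blockNorm n α s p q g := fun r hr =>
    le_csInf ⟨_, _, _, k₀, rfl⟩ fun r' hr' => by linarith [key r hr r' hr']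
  have h2 : blockNorm n α s p q (f + g) - blockNorm n α s p q g ≤ blockNorm n α s p q f :=
    le_csInf ⟨_, _, _, h₀, rfl⟩ fun r hr => by linarith [h1 r hr]
  linarith

theorem blockNorm_smul_le {n : ℕ} {α s p q : ℝ} {f : Rn n →ₘ[volume] ℝ}
    (hf : f ∈ blockSubmodule n α s p q) (a : ℝ) :
    blockNorm n α s p q (a • f) ≤ |a| * blockNorm n α s p q f := by
  obtain ⟨c₀, b₀, h₀⟩ := hf
  rcases eq_or_ne a 0 with rfl | ha
  · simp [blockNorm_zero]
  have ha' : 0 < |a| := abs_pos.2 ha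
  have h : |a|⁻¹ * blockNorm n α s p q (a • f) ≤ blockNorm n α s p q f := by
    refine le_csInf ⟨_, _, _, h₀, rfl⟩ ?_
    rintro _ ⟨c, b, h, rfl⟩
    rw [inv_mul_le_iff₀ ha']
    refine csInf_le (blockSums_bddBelow n α s p q _) ⟨_, _, h.smul a, ?_⟩
    simp only [abs_mul, tsum_mul_left]
  rwa [inv_mul_le_iff₀ ha'] at h

/-- The block space `𝓑^{p,q}`, built on the capacity `Cap_{α,s}` on `ℝⁿ`. -/
def BlockSpace (n : ℕ) (α s p q : ℝ) : Type := ↥(blockSubmodule n α s p q)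

instance (n : ℕ) (α s p q : ℝ) : AddCommGroup (BlockSpace n α s p q) :=
  inferInstanceAs (AddCommGroup ↥(blockSubmodule n α s p q))

instance (n : ℕ) (α s p q : ℝ) : Module ℝ (BlockSpace n α s p q) :=
  inferInstanceAs (Module ℝ ↥(blockSubmodule n α s p q))

/-- The class of functions modulo a.e. equality that an element of `𝓑^{p,q}` is. -/
def BlockSpace.toFun {n : ℕ} {α s p q : ℝ} (g : BlockSpace n α s p q) : Rn n →ₘ[volume] ℝ :=
  Subtype.val (p := fun f => f ∈ blockSubmodule n α s p q) g

theorem BlockSpace.mem {n : ℕ} {α s p q : ℝ} (g : BlockSpace n α s p q) :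
    g.toFun ∈ blockSubmodule n α s p q :=
  Subtype.property (p := fun f => f ∈ blockSubmodule n α s p q) g

/-- `𝓑^{p,q}` carries the (semi)norm `‖·‖_{𝓑^{p,q}}` and the topology that it induces. -/
instance (n : ℕ) (α s p q : ℝ) : SeminormedAddCommGroup (BlockSpace n α s p q) :=
  AddGroupSeminorm.toSeminormedAddCommGroup
    { toFun := fun g => blockNorm n α s p q g.toFun
      map_zero' := blockNorm_zero n α s p q
      add_le' := fun f g => blockNorm_add_le f.mem g.mem
      neg' := fun f => by
        have key : ∀ g : BlockSpace n α s p q,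
            blockNorm n α s p q (-g).toFun ≤ blockNorm n α s p q g.toFun := fun g => by
          have h := blockNorm_smul_le g.mem (-1)
          rw [abs_neg, abs_one, one_mul, neg_one_smul] at h
          exact h
        refine le_antisymm (key f) ?_
        have h := key (-f)
        rwa [neg_neg] at h }

theorem BlockSpace.norm_def {n : ℕ} {α s p q : ℝ} (g : BlockSpace n α s p q) :
    ‖g‖ = blockNorm n α s p q g.toFun := rfl

instance (n : ℕ) (α s p q : ℝ) : NormedSpace ℝ (BlockSpace n α s p q) where
  norm_smul_le := fun a g => blockNorm_smul_le g.mem a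

/-- The functional `L` on `𝓑^{p,q}` is `g ↦ ∫ f g` (with an absolutely convergent integral). -/
def IsRepresentedBy {n : ℕ} {α s p q : ℝ} (L : StrongDual ℝ (BlockSpace n α s p q))
    (f : Rn n →ₘ[volume] ℝ) : Prop :=
  ∀ g : BlockSpace n α s p q,
    Integrable (fun x => g.toFun x * f x) ∧ L g = ∫ x, g.toFun x * f x

end SobolevMultiplier

end

namespace SobolevMultiplier

/-! ### Bessel capacities -/

/-! Write `r` for the exponent conjugate to `p`. Two facts about the capacity are used throughout:
it dominates Lebesgue measure (`volume_le_besselCap`), so sets of capacity zero are null, and it is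
finite on bounded sets (`besselCap_lt_top`).

Multipliers act on blocks by Hölder. Since `q ≤ 1`, `L^{r,q}` embeds in `L^{r,1}`, which pairs with
`L^{p,∞}`. For a block `b` supported in `E` this gives `∫ |f b| ≤ C ‖f‖_𝓜 Cap(E)^(1/p) ‖b‖_{r,q} ≤ C
‖f‖_𝓜`; summing a decomposition bounds the pairing (`lintegral_enorm_mul_le_tsum`).

Conversely, for measurable `A ⊆ E` with `E` bounded, `χ_A` has block norm at most `C Cap(E)^(1/p)
|A|^(1/r)`. Hence `A ↦ L(χ_A)` is countably additive and absolutely continuous on bounded sets, and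
Radon–Nikodym gives a density `f` (`exists_representsIndicators`). Testing `L` on `sgn f` over `A =
K ∩ {|f| > t}` gives `t |A| ≤ C ‖L‖ Cap(K)^(1/p) |A|^(1/r)`; dividing by `|A|^(1/r)` puts `f` in
`𝓜^{p,∞}` with norm at most `C ‖L‖` (`RepresentsIndicators.weakMultiplierNorm_le`).

So `f` defines a functional that agrees with `L` on indicators. It equals `L` everywhere
(`strongDual_eq_zero`): simple functions approximate each block in norm, and tails of a
decomposition are small in norm. Uniqueness is the same lower bound applied to the zero functional.
-/

theorem besselCap_mono {n : ℕ} {α s : ℝ} {E F : Set (Rn n)} (h : E ⊆ F) :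
    besselCap n α s E ≤ besselCap n α s F :=
  iInf_mono fun _ => iInf_mono fun _ => le_iInf fun hF => iInf_le_of_le (fun x hx => hF x (h hx))
    le_rfl

/-- Jensen's inequality for an average. -/
theorem lintegral_rpow_le_of_isProbabilityMeasure {X : Type*} [MeasurableSpace X] (μ : Measure X)
    [IsProbabilityMeasure μ] {s : ℝ} (hs : 1 < s) {h : X → ℝ≥0∞} (hh : AEMeasurable h μ) :
    (∫⁻ x, h x ∂μ) ^ s ≤ ∫⁻ x, h x ^ s ∂μ := by
  have hc := Real.HolderConjugate.conjExponent hs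
  have key := ENNReal.lintegral_mul_le_Lp_mul_Lq μ hc hh (aemeasurable_const (b := (1 : ℝ≥0∞)))
  simp only [Pi.mul_apply, mul_one, ENNReal.one_rpow, lintegral_const, measure_univ] at key
  rwa [one_div, ENNReal.le_rpow_inv_iff (by linarith)] at key

/-- Young's inequality for a kernel of mass one: `G_α(x - y) dy` is a probability measure, so Jensen
applies for each `x`, and Tonelli integrates out `x`. -/
theorem lintegral_besselConv_rpow_le {n : ℕ} {α s : ℝ} (hα : 0 < α) (hs : 1 < s)
    {h : Rn n → ℝ≥0∞} (hh : Measurable h) :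
    ∫⁻ x, besselConv n α h x ^ s ≤ ∫⁻ x, h x ^ s := by
  have hG := measurable_besselKernel n α
  have h1 : ∀ x, besselConv n α h x ^ s ≤ ∫⁻ y, besselKernel n α (x - y) * h y ^ s := by
    intro x
    have hGx : Measurable fun y => besselKernel n α (x - y) := hG.comp (measurable_const_sub x)
    have : IsProbabilityMeasure (volume.withDensity fun y => besselKernel n α (x - y)) := by
      refine ⟨?_⟩
      rw [withDensity_apply _ MeasurableSet.univ, setLIntegral_univ,
        lintegral_sub_left_eq_self (besselKernel n α) x, lintegral_besselKernel n hα]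
    have key := lintegral_rpow_le_of_isProbabilityMeasure
      (volume.withDensity fun y => besselKernel n α (x - y)) hs hh.aemeasurable
    rwa [lintegral_withDensity_eq_lintegral_mul _ hGx hh,
      lintegral_withDensity_eq_lintegral_mul _ hGx (hh.pow_const s)] at key
  have hm : Measurable fun z : Rn n × Rn n => besselKernel n α (z.1 - z.2) * h z.2 ^ s :=
    (hG.comp (measurable_fst.sub measurable_snd)).mul ((hh.comp measurable_snd).pow_const s)
  calc ∫⁻ x, besselConv n α h x ^ s ≤ ∫⁻ x, ∫⁻ y, besselKernel n α (x - y) * h y ^ s :=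
        lintegral_mono h1
    _ = ∫⁻ y, ∫⁻ x, besselKernel n α (x - y) * h y ^ s :=
        lintegral_lintegral_swap hm.aemeasurable
    _ = ∫⁻ y, h y ^ s := by
        refine lintegral_congr fun y => ?_
        have hGy : Measurable fun x => besselKernel n α (x - y) := hG.comp (measurable_sub_const y)
        rw [lintegral_mul_const _ hGy,
          lintegral_sub_right_eq_self (besselKernel n α) y, lintegral_besselKernel n hα, one_mul]

/-- The Bessel capacity dominates Lebesgue (outer) measure. -/
theorem volume_le_besselCap {n : ℕ} {α s : ℝ} (hα : 0 < α) (hs : 1 < s) (E : Set (Rn n)) :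
    volume E ≤ besselCap n α s E := by
  refine le_iInf fun h => le_iInf fun hh => le_iInf fun hE => ?_
  have hm : Measurable (besselConv n α h) :=
    Measurable.lintegral_prod_right'
      (f := fun z : Rn n × Rn n => besselKernel n α (z.1 - z.2) * h z.2)
      (((measurable_besselKernel n α).comp (measurable_fst.sub measurable_snd)).mul
        (hh.comp measurable_snd))
  -- Chebyshev at level 1 for `(G_α * h)^s`, whose superlevel set contains `E`.
  have h2 := mul_meas_ge_le_lintegral (μ := volume) (hm.pow_const s) 1
  rw [one_mul] at h2
  refine (measure_mono fun x hx => ?_).trans (h2.trans (lintegral_besselConv_rpow_le hα hs hh))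
  exact ENNReal.one_le_rpow (hE x hx) (by linarith)

theorem exists_setLIntegral_besselKernel_ne_zero (n : ℕ) {α : ℝ} (hα : 0 < α) :
    ∃ ρ : ℝ, ∫⁻ x in Metric.ball (0 : Rn n) ρ, besselKernel n α x ≠ 0 := by
  by_contra! h
  have h1 := lintegral_iUnion_le (μ := volume) (fun k : ℕ => Metric.ball (0 : Rn n) k)
    (besselKernel n α)
  rw [Metric.iUnion_ball_nat, setLIntegral_univ, lintegral_besselKernel n hα] at h1
  simp [h] at h1

/-- The test function is constant on a large ball. If `E ⊆ B(0, R)` and `G_α` has mass `I > 0` on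
`B(0, ρ)`, the value `I⁻¹` on `B(0, R + ρ)` already makes the convolution at least 1 on `E`. -/
theorem besselCap_lt_top {n : ℕ} {α s : ℝ} (hα : 0 < α) (hs : 1 < s) {E : Set (Rn n)}
    (hE : Bornology.IsBounded E) : besselCap n α s E < ∞ := by
  obtain ⟨ρ, hρ⟩ := exists_setLIntegral_besselKernel_ne_zero n hα
  obtain ⟨R, hR⟩ := hE.subset_ball 0
  set I := ∫⁻ x in Metric.ball (0 : Rn n) ρ, besselKernel n α x with hI
  have hI1 : I ≠ ∞ := ((setLIntegral_le_lintegral _ _).trans_lt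
    (by rw [lintegral_besselKernel n hα]; exact ENNReal.one_lt_top)).ne
  set B := Metric.ball (0 : Rn n) (R + ρ) with hB
  have hBm : MeasurableSet B := Metric.isOpen_ball.measurableSet
  refine lt_of_le_of_lt (iInf_le_of_le (B.indicator fun _ => I⁻¹) <| iInf_le_of_le
    (measurable_const.indicator hBm) <| iInf_le_of_le (fun x hx => ?_) le_rfl) ?_
  · have hGx : Measurable fun y =>
        (Metric.ball (0 : Rn n) ρ).indicator (besselKernel n α) (x - y) :=
      ((measurable_besselKernel n α).indicator Metric.isOpen_ball.measurableSet).comp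
        (measurable_const_sub x)
    have h1 : (1 : ℝ≥0∞) = ∫⁻ y, (Metric.ball (0 : Rn n) ρ).indicator (besselKernel n α) (x - y)
        * I⁻¹ := by
      rw [lintegral_mul_const _ hGx, lintegral_sub_left_eq_self, lintegral_indicator Metric.isOpen_ball.measurableSet, ← hI,
        ENNReal.mul_inv_cancel hρ hI1]
    rw [h1]
    refine lintegral_mono fun y => ?_
    by_cases hy : x - y ∈ Metric.ball (0 : Rn n) ρ
    · have hyB : y ∈ B := by
        have hx' := hR hx
        rw [mem_ball_zero_iff] at hy hx'
        rw [hB, mem_ball_zero_iff]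
        have := norm_sub_le x (x - y)
        rw [sub_sub_cancel] at this
        linarith
      rw [Set.indicator_of_mem hy, Set.indicator_of_mem hyB]
    · rw [Set.indicator_of_notMem hy, zero_mul]
      exact zero_le
  · have h2 : ∀ x, B.indicator (fun _ => I⁻¹) x ^ s = B.indicator (fun _ => I⁻¹ ^ s) x := by
      intro x
      by_cases hx : x ∈ B
      · simp [hx]
      · simp [hx, show 0 < s by linarith]
    simp_rw [h2]
    rw [lintegral_indicator hBm, setLIntegral_const]
    exact ENNReal.mul_lt_top (ENNReal.rpow_lt_top_of_nonneg (by linarith) (by simpa using hρ))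
      Metric.isBounded_ball.measure_lt_top

/-! ### Lorentz quasi-norms -/

theorem setLIntegral_Ioc_rpow_div {q a : ℝ} (hq : 0 < q) (ha : 0 ≤ a) :
    ∫⁻ t in Set.Ioc 0 a, ENNReal.ofReal (t ^ q / t) = ENNReal.ofReal (a ^ q / q) := by
  have h1 : ∀ t ∈ Set.Ioc 0 a, ENNReal.ofReal (t ^ q / t) = ENNReal.ofReal (t ^ (q - 1)) :=
    fun t ht => by rw [Real.rpow_sub_one ht.1.ne']
  rw [setLIntegral_congr_fun measurableSet_Ioc h1, ← ofReal_integral_eq_lintegral_ofReal,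
    ← intervalIntegral.integral_of_le ha, integral_rpow (Or.inl (by linarith))]
  · simp [hq.ne']
  · rw [← IntegrableOn, ← intervalIntegrable_iff_integrableOn_Ioc_of_le ha]
    exact intervalIntegral.intervalIntegrable_rpow' (by linarith)
  · filter_upwards [ae_restrict_mem measurableSet_Ioc] with t ht
    exact Real.rpow_nonneg ht.1.le _

theorem lorentzNorm_congr {n : ℕ} {r q : ℝ} {φ ψ : Rn n → ℝ} (h : φ =ᵐ[volume] ψ) :
    lorentzNorm r q φ = lorentzNorm r q ψ := by
  have : ∀ t : ℝ, volume {x | t < |φ x|} = volume {x | t < |ψ x|} := fun t => by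
    refine measure_congr ?_
    filter_upwards [h] with x hx
    change (t < |φ x|) = (t < |ψ x|)
    rw [hx]
  simp only [lorentzNorm, this]

/-- The constant in `‖χ_A‖_{L^{r,q}} = (r / q) ^ (1/q) |A| ^ (1/r)`. -/
noncomputable def indicatorConst (r q : ℝ) : ℝ≥0∞ :=
  ENNReal.ofReal r ^ (1 / q) * ENNReal.ofReal (1 / q) ^ (1 / q)

theorem indicatorConst_ne_top {r q : ℝ} (hq : 0 < q) : indicatorConst r q ≠ ∞ :=
  ENNReal.mul_ne_top (ENNReal.rpow_ne_top_of_nonneg (by positivity) ENNReal.ofReal_ne_top)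
    (ENNReal.rpow_ne_top_of_nonneg (by positivity) ENNReal.ofReal_ne_top)

/-- The level sets lie in `A` for `t ≤ 1` and are empty above. A bound on `|φ|` is assumed, rather
than `φ = χ_A`, to cover `χ_P - χ_Q` with `P`, `Q` disjoint. -/
theorem lorentzNorm_le_of_abs_le_indicator {n : ℕ} {r q : ℝ} (hr : 0 < r) (hq : 0 < q)
    {φ : Rn n → ℝ} {A : Set (Rn n)} (h : ∀ x, |φ x| ≤ A.indicator (fun _ => 1) x) :
    lorentzNorm r q φ ≤ indicatorConst r q * volume A ^ (1 / r) := by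
  have h1 : ∫⁻ t in Set.Ioi (0 : ℝ),
      volume {x | t < |φ x|} ^ (q / r) * ENNReal.ofReal (t ^ q / t) ≤
      volume A ^ (q / r) * ENNReal.ofReal (1 / q) := by
    have h2 := setLIntegral_Ioc_rpow_div hq zero_le_one
    rw [Real.one_rpow] at h2
    rw [← h2, ← lintegral_const_mul _ (by fun_prop), ← lintegral_indicator measurableSet_Ioc,
      ← lintegral_indicator measurableSet_Ioi]
    refine lintegral_mono fun t => ?_
    by_cases ht : t ∈ Set.Ioi (0 : ℝ)
    · rw [Set.indicator_of_mem ht]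
      by_cases ht1 : t ≤ 1
      · rw [Set.indicator_of_mem (show t ∈ Set.Ioc (0 : ℝ) 1 from ⟨ht, ht1⟩)]
        gcongr
        intro x hx
        by_contra hxA
        have h3 := h x
        rw [Set.indicator_of_notMem hxA] at h3
        exact absurd (lt_trans ht hx) (not_lt.2 h3)
      · have : {x | t < |φ x|} = ∅ := by
          refine Set.eq_empty_of_forall_notMem fun x hx => ht1 ?_
          exact (le_of_lt hx).trans ((h x).trans (Set.indicator_le_self' (by simp) x))
        rw [this, measure_empty, ENNReal.zero_rpow_of_pos (by positivity), zero_mul]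
        exact zero_le
    · rw [Set.indicator_of_notMem ht]
      exact zero_le
  unfold lorentzNorm indicatorConst
  calc _ ≤ ENNReal.ofReal r ^ (1 / q) *
        (volume A ^ (q / r) * ENNReal.ofReal (1 / q)) ^ (1 / q) := by gcongr
    _ = _ := by
      rw [ENNReal.mul_rpow_of_nonneg _ _ (by positivity), ← ENNReal.rpow_mul,
        show q / r * (1 / q) = 1 / r by field_simp]
      ring

theorem lorentzNorm_const_mul {n : ℕ} {r q a : ℝ} (hq : 0 < q) (ha : 0 < a) (φ : Rn n → ℝ) :
    lorentzNorm r q (fun x => a * φ x) = ENNReal.ofReal a * lorentzNorm r q φ := by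
  set F : ℝ → ℝ≥0∞ := fun t => volume {x | t < |φ x|} ^ (q / r) * ENNReal.ofReal (t ^ q / t)
    with hF
  have h1 : ∀ t ∈ Set.Ioi (0 : ℝ), volume {x | t < |a * φ x|} ^ (q / r) *
      ENNReal.ofReal (t ^ q / t) = ENNReal.ofReal (a ^ q * a⁻¹) * F (a⁻¹ * t) := by
    intro t ht
    have ht0 : 0 < t := ht
    have h2 : {x | t < |a * φ x|} = {x | a⁻¹ * t < |φ x|} := by
      ext x
      simp only [Set.mem_ofPred_eq, abs_mul, abs_of_pos ha]
      rw [inv_mul_lt_iff₀ ha]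
    rw [h2, hF]
    simp only
    rw [mul_left_comm, ← ENNReal.ofReal_mul (by positivity), Real.mul_rpow (by positivity) ht0.le,
      Real.inv_rpow ha.le]
    congr 2
    have := (Real.rpow_pos_of_pos ha q).ne'
    field_simp
  have h3 : ∫⁻ t in Set.Ioi (0 : ℝ), F (a⁻¹ * t) =
      ENNReal.ofReal a * ∫⁻ t in Set.Ioi (0 : ℝ), F t := by
    have hemb : MeasurableEmbedding fun t : ℝ => a⁻¹ * t :=
      (Homeomorph.mulLeft₀ a⁻¹ (inv_ne_zero ha.ne')).measurableEmbedding
    have hpre : (fun t : ℝ => a⁻¹ * t) ⁻¹' Set.Ioi 0 = Set.Ioi 0 := by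
      ext t
      simp [ha]
    have h4 := hemb.lintegral_map (μ := volume.restrict (Set.Ioi 0)) F
    rw [← h4, ← hpre, ← hemb.restrict_map, Real.map_volume_mul_left (inv_ne_zero ha.ne'), inv_inv,
      abs_of_pos ha, Measure.restrict_smul, lintegral_smul_measure, hpre, smul_eq_mul]
  unfold lorentzNorm
  rw [setLIntegral_congr_fun measurableSet_Ioi h1, lintegral_const_mul' _ _ ENNReal.ofReal_ne_top,
    h3, ← mul_assoc, ← ENNReal.ofReal_mul (by positivity),
    show a ^ q * a⁻¹ * a = a ^ q by field_simp, ENNReal.mul_rpow_of_nonneg _ _ (by positivity),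
    ENNReal.ofReal_rpow_of_pos (Real.rpow_pos_of_pos ha q), ← Real.rpow_mul ha.le,
    mul_one_div_cancel hq.ne', Real.rpow_one]
  ring

theorem antitone_volume_lt {n : ℕ} (φ : Rn n → ℝ) :
    Antitone fun t : ℝ => volume {x | t < |φ x|} :=
  fun _ _ hst => measure_mono fun _ hx => lt_of_le_of_lt hst hx

/-- The embedding `L^{q}(t^q dt/t) ⊆ L^1(dt)` for nonincreasing functions, `q ≤ 1`. -/
theorem lintegral_le_of_antitone {q : ℝ} (hq : 0 < q) (hq1 : q ≤ 1) {φ : ℝ → ℝ≥0∞}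
    (hφ : Antitone φ) :
    ∫⁻ t in Set.Ioi (0 : ℝ), φ t ≤ ENNReal.ofReal q ^ ((1 - q) / q) *
      (∫⁻ t in Set.Ioi (0 : ℝ), φ t ^ q * ENNReal.ofReal (t ^ q / t)) ^ (1 / q) := by
  set I := ∫⁻ t in Set.Ioi (0 : ℝ), φ t ^ q * ENNReal.ofReal (t ^ q / t) with hI
  have hpow : 0 ≤ (1 - q) / q := div_nonneg (by linarith) hq.le
  have hφm : Measurable φ := hφ.measurable
  -- By monotonicity `φ t ^ q * t ^ q / q` is at most the part of `I` over `(0, t]`, so `t φ(t)` is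
  -- bounded.
  have h1 : ∀ t : ℝ, 0 < t → (φ t * ENNReal.ofReal t) ^ q ≤ ENNReal.ofReal q * I := by
    intro t ht
    have h2 : φ t ^ q * ENNReal.ofReal (t ^ q / q) ≤ I := by
      rw [← setLIntegral_Ioc_rpow_div hq ht.le, ← lintegral_const_mul _ (by fun_prop)]
      refine (setLIntegral_mono' measurableSet_Ioc fun u hu => ?_).trans
        (lintegral_mono_set Set.Ioc_subset_Ioi_self)
      gcongr
      exact hφ hu.2
    calc (φ t * ENNReal.ofReal t) ^ q
        = ENNReal.ofReal q * (φ t ^ q * ENNReal.ofReal (t ^ q / q)) := by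
          rw [ENNReal.mul_rpow_of_nonneg _ _ hq.le, ENNReal.ofReal_rpow_of_pos ht, mul_left_comm,
            ← ENNReal.ofReal_mul hq.le, mul_div_cancel₀ _ hq.ne']
      _ ≤ _ := by gcongr
  -- With `u = t φ(t)`, write `φ(t) = u^(1-q) · u^q / t`: the first factor is bounded by `h1`, and
  -- the second is the integrand of `I`.
  have h3 : ∀ t ∈ Set.Ioi (0 : ℝ), φ t ≤ (ENNReal.ofReal q * I) ^ ((1 - q) / q) *
      (φ t ^ q * ENNReal.ofReal (t ^ q / t)) := by
    intro t ht
    have ht0 : 0 < t := ht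
    set u := φ t * ENNReal.ofReal t with hu
    have h4 : u = u ^ (1 - q) * u ^ q := by
      rw [← ENNReal.rpow_add_of_nonneg _ _ (by linarith) hq.le, sub_add_cancel, ENNReal.rpow_one]
    have h5 : u ^ (1 - q) ≤ (ENNReal.ofReal q * I) ^ ((1 - q) / q) := by
      refine le_trans (le_of_eq ?_) (ENNReal.rpow_le_rpow (h1 t ht0) hpow)
      rw [← ENNReal.rpow_mul]
      congr 1
      field_simp
    have h6 : φ t = u * ENNReal.ofReal t⁻¹ := by
      rw [hu, mul_assoc, ← ENNReal.ofReal_mul ht0.le, mul_inv_cancel₀ ht0.ne', ENNReal.ofReal_one,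
        mul_one]
    calc φ t = u ^ (1 - q) * u ^ q * ENNReal.ofReal t⁻¹ := by rw [← h4, ← h6]
      _ ≤ (ENNReal.ofReal q * I) ^ ((1 - q) / q) * u ^ q * ENNReal.ofReal t⁻¹ := by gcongr
      _ = _ := by
        rw [hu, ENNReal.mul_rpow_of_nonneg _ _ hq.le, ENNReal.ofReal_rpow_of_pos ht0, mul_assoc,
          mul_assoc, ← ENNReal.ofReal_mul (by positivity), ← div_eq_mul_inv]
  refine (setLIntegral_mono' measurableSet_Ioi h3).trans (le_of_eq ?_)
  rw [lintegral_const_mul _ (by fun_prop), ← hI, ENNReal.mul_rpow_of_nonneg _ _ hpow, mul_assoc]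
  congr 1
  nth_rw 2 [← ENNReal.rpow_one I]
  rw [← ENNReal.rpow_add_of_nonneg _ _ hpow zero_le_one]
  congr 1
  field_simp
  ring

/-- The constant in the embedding `L^{r,q} ⊆ L^{r,1}`, `q ≤ 1`. -/
noncomputable def embeddingConst (r q : ℝ) : ℝ≥0∞ :=
  ENNReal.ofReal q ^ ((1 - q) / q) * (ENNReal.ofReal r ^ (1 / q))⁻¹

theorem embeddingConst_ne_top {r q : ℝ} (hr : 0 < r) (hq : 0 < q) (hq1 : q ≤ 1) :
    embeddingConst r q ≠ ∞ :=
  ENNReal.mul_ne_top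
    (ENNReal.rpow_ne_top_of_nonneg (div_nonneg (by linarith) hq.le) ENNReal.ofReal_ne_top)
    (ENNReal.inv_ne_top.2 (ENNReal.rpow_pos (by simpa using hr) ENNReal.ofReal_ne_top).ne')

theorem lintegral_volume_rpow_le_lorentzNorm {n : ℕ} {r q : ℝ} (hr : 0 < r) (hq : 0 < q)
    (hq1 : q ≤ 1) (φ : Rn n → ℝ) :
    ∫⁻ t in Set.Ioi (0 : ℝ), volume {x | t < |φ x|} ^ (1 / r) ≤
      embeddingConst r q * lorentzNorm r q φ := by
  have hanti : Antitone fun t : ℝ => volume {x | t < |φ x|} ^ (1 / r) := fun s t hst =>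
    ENNReal.rpow_le_rpow (antitone_volume_lt φ hst) (by positivity)
  refine (lintegral_le_of_antitone hq hq1 hanti).trans (le_of_eq ?_)
  have h0 : ENNReal.ofReal r ^ (1 / q) ≠ 0 :=
    (ENNReal.rpow_pos (by simpa using hr) ENNReal.ofReal_ne_top).ne'
  have h1 : ENNReal.ofReal r ^ (1 / q) ≠ ∞ :=
    ENNReal.rpow_ne_top_of_nonneg (by positivity) ENNReal.ofReal_ne_top
  unfold embeddingConst lorentzNorm
  rw [mul_assoc, ← mul_assoc (ENNReal.ofReal r ^ (1 / q))⁻¹, ENNReal.inv_mul_cancel h0 h1, one_mul]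
  simp_rw [← ENNReal.rpow_mul, one_div_mul_eq_div]

/-- Functions of weak type `L^{p,∞}` are integrable on sets of finite measure. -/
theorem setLIntegral_enorm_le_of_weak {n : ℕ} {p r : ℝ} (hpr : p.HolderConjugate r)
    {f : Rn n → ℝ} (hf : Measurable f) {A : Set (Rn n)} (hA : volume A ≠ ∞) {M : ℝ≥0∞}
    (hM : ∀ t : ℝ, 0 < t → ENNReal.ofReal t * volume (A ∩ {x | t < |f x|}) ^ (1 / p) ≤ M) :
    ∫⁻ x in A, ‖f x‖ₑ ≤ ENNReal.ofReal r * M * volume A ^ (1 / r) := by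
  have hp := hpr.lt
  have hr : 0 < r := hpr.symm.pos
  have hp0 : 0 < p := hpr.pos
  rcases eq_or_ne (volume A) 0 with hA0 | hA0
  · rw [Measure.restrict_zero_set hA0]
    simp
  have hlc : ∫⁻ x in A, ‖f x‖ₑ = ∫⁻ t in Set.Ioi (0 : ℝ), volume (A ∩ {x | t < |f x|}) := by
    simp_rw [← ofReal_norm, Real.norm_eq_abs]
    rw [lintegral_eq_lintegral_meas_lt _ (Eventually.of_forall fun x => abs_nonneg _)
      (by fun_prop)]
    refine lintegral_congr fun t => ?_
    rw [Measure.restrict_apply (measurableSet_lt measurable_const (by fun_prop)), Set.inter_comm]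
  rw [hlc]
  rcases eq_or_ne M ∞ with rfl | hMt
  · rw [ENNReal.mul_top (by simpa using hr), ENNReal.top_mul]
    · exact le_top
    · exact (ENNReal.rpow_pos (pos_iff_ne_zero.2 hA0) hA).ne'
  rcases eq_or_ne M 0 with rfl | hM0
  · have h0 : ∀ t ∈ Set.Ioi (0 : ℝ), volume (A ∩ {x | t < |f x|}) = 0 := by
      intro t ht
      have h1 := le_zero_iff.1 (hM t ht)
      rcases mul_eq_zero.1 h1 with h2 | h2
      · exact absurd (ENNReal.ofReal_eq_zero.1 h2) (not_le.2 ht)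
      · exact (ENNReal.rpow_eq_zero_iff_of_pos (by positivity)).1 h2
    rw [setLIntegral_congr_fun measurableSet_Ioi h0]
    simp
  obtain ⟨v, hv, hvA⟩ : ∃ v : ℝ, 0 < v ∧ volume A = ENNReal.ofReal v :=
    ⟨_, ENNReal.toReal_pos hA0 hA, (ENNReal.ofReal_toReal hA).symm⟩
  obtain ⟨m, hm, rfl⟩ : ∃ m : ℝ, 0 < m ∧ M = ENNReal.ofReal m :=
    ⟨_, ENNReal.toReal_pos hM0 hMt, (ENNReal.ofReal_toReal hMt).symm⟩
  -- The level at which the two bounds `v` and `(m / t)^p` for the distribution function coincide.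
  -- The first is integrated below `a`, the second above; the sum is `(1 + 1/(p - 1)) m v^(1/r) = r
  -- m v^(1/r)`.
  set a : ℝ := m * v ^ (-(1 / p)) with ha
  have ha0 : 0 < a := by positivity
  rw [← Set.Ioc_union_Ioi_eq_Ioi ha0.le]
  refine (lintegral_union_le _ _ _).trans ?_
  have h1 : ∫⁻ t in Set.Ioc 0 a, volume (A ∩ {x | t < |f x|}) ≤ ENNReal.ofReal (v * a) := by
    refine (setLIntegral_mono' measurableSet_Ioc fun t _ =>
      measure_mono Set.inter_subset_left).trans ?_
    rw [setLIntegral_const, Real.volume_Ioc, hvA, sub_zero, ENNReal.ofReal_mul hv.le]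
  have h2 : ∫⁻ t in Set.Ioi a, volume (A ∩ {x | t < |f x|}) ≤
      ENNReal.ofReal (m ^ p * (-a ^ (-p + 1) / (-p + 1))) := by
    rw [← integral_Ioi_rpow_of_lt (by linarith) ha0, ← integral_const_mul,
      ofReal_integral_eq_lintegral_ofReal
        ((integrableOn_Ioi_rpow_of_lt (by linarith) ha0).const_mul _)]
    · refine setLIntegral_mono' measurableSet_Ioi fun t ht => ?_
      have ht0 : 0 < t := ha0.trans ht
      have h3 := hM t ht0
      have h4 : volume (A ∩ {x | t < |f x|}) ^ (1 / p) ≤ ENNReal.ofReal (m * t⁻¹) := by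
        rw [ENNReal.ofReal_mul hm.le, ENNReal.ofReal_inv_of_pos ht0, ← div_eq_mul_inv,
          ENNReal.le_div_iff_mul_le (Or.inl (by simpa using ht0)) (Or.inl ENNReal.ofReal_ne_top),
          mul_comm]
        exact h3
      rw [one_div, ENNReal.rpow_inv_le_iff hp0, ENNReal.ofReal_rpow_of_pos (by positivity),
        Real.mul_rpow hm.le (by positivity), Real.inv_rpow ht0.le, ← Real.rpow_neg ht0.le] at h4
      exact h4
    · filter_upwards [ae_restrict_mem measurableSet_Ioi] with t ht
      have ht0 : 0 < t := ha0.trans ht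
      simp only [Pi.zero_apply]
      positivity
  have hr' : r = 1 + 1 / (p - 1) := by
    rw [hpr.conjugate_eq]
    field_simp [sub_ne_zero.2 hp.ne']
    ring
  have hinv : 1 / r = 1 - 1 / p := by
    have := hpr.inv_add_inv_eq_one
    rw [one_div, one_div]
    linarith
  have e1 : v * a = m * v ^ (1 / r) := by
    rw [ha, hinv, sub_eq_add_neg, Real.rpow_add hv, Real.rpow_one]
    ring
  have e2 : m ^ p * (-a ^ (-p + 1) / (-p + 1)) = 1 / (p - 1) * (m * v ^ (1 / r)) := by
    have h5 : a ^ (-p + 1) = m ^ (-p + 1) * v ^ (1 / r) := by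
      rw [ha, Real.mul_rpow hm.le (by positivity), ← Real.rpow_mul hv.le, hinv]
      congr 2
      field_simp
      ring
    have h6 : m ^ p * m ^ (-p + 1) = m := by
      rw [← Real.rpow_add hm]
      simp
    have h7 : p - 1 ≠ 0 := sub_ne_zero.2 hp.ne'
    have h8 : -p + 1 = -(p - 1) := by ring
    rw [h5, div_eq_mul_inv, h8, inv_neg, ← h8]
    calc m ^ p * (-(m ^ (-p + 1) * v ^ (1 / r)) * -(p - 1)⁻¹)
        = (m ^ p * m ^ (-p + 1)) * v ^ (1 / r) * (p - 1)⁻¹ := by ring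
      _ = _ := by rw [h6]; ring
  refine (add_le_add h1 h2).trans (le_of_eq ?_)
  rw [e1, e2, hvA, ENNReal.ofReal_rpow_of_pos hv, ← ENNReal.ofReal_mul hr.le,
    ← ENNReal.ofReal_mul (by positivity), ← ENNReal.ofReal_add (by positivity)
      (by have : 0 < p - 1 := by linarith
          positivity)]
  congr 1
  nth_rw 3 [hr']
  ring

/-- Hölder's inequality between `L^{p,∞}` and `L^{r,q}`, `q ≤ 1`. -/
theorem lintegral_enorm_mul_le_of_weak {n : ℕ} {p r q : ℝ} (hpr : p.HolderConjugate r)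
    (hq : 0 < q) (hq1 : q ≤ 1) {f b : Rn n → ℝ} (hf : Measurable f) (hb : AEMeasurable b volume)
    (hfin : volume {x | b x ≠ 0} ≠ ∞) {M : ℝ≥0∞}
    (hM : ∀ t : ℝ, 0 < t →
      ENNReal.ofReal t * volume ({x | b x ≠ 0} ∩ {x | t < |f x|}) ^ (1 / p) ≤ M) :
    ∫⁻ x, ‖f x‖ₑ * ‖b x‖ₑ ≤
      ENNReal.ofReal r * embeddingConst r q * (M * lorentzNorm r q b) := by
  have hsub : ∀ t : ℝ, 0 < t → {x | t < |b x|} ⊆ {x | b x ≠ 0} := fun t ht x hx h0 => by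
    simp only [Set.mem_ofPred_eq, h0, abs_zero] at hx
    exact absurd ht (not_lt.2 hx.le)
  have hanti := antitone_volume_lt b
  -- Layer-cake formula for `|b|` with respect to the measure `|f| dx`.
  have h1 : ∫⁻ x, ‖f x‖ₑ * ‖b x‖ₑ = ∫⁻ t in Set.Ioi (0 : ℝ), ∫⁻ x in {x | t < |b x|}, ‖f x‖ₑ := by
    rw [← Pi.mul_def, ← lintegral_withDensity_eq_lintegral_mul₀ hf.enorm.aemeasurable hb.enorm]
    simp_rw [← ofReal_norm (b _), Real.norm_eq_abs]
    rw [lintegral_eq_lintegral_meas_lt _ (Eventually.of_forall fun x => abs_nonneg _)]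
    · exact lintegral_congr fun t => withDensity_apply' _ _
    · exact (hb.mono_ac (withDensity_absolutelyContinuous _ _)).abs
  rw [h1]
  calc _ ≤ ∫⁻ t in Set.Ioi (0 : ℝ),
        ENNReal.ofReal r * M * volume {x | t < |b x|} ^ (1 / r) := by
        refine setLIntegral_mono' measurableSet_Ioi fun t ht =>
          setLIntegral_enorm_le_of_weak hpr hf
            ((measure_mono (hsub t ht)).trans_lt hfin.lt_top).ne fun u hu => ?_
        refine le_trans ?_ (hM u hu)
        have := hpr.pos
        gcongr
        exact fun hx => hsub t ht hx
    _ = ENNReal.ofReal r * M * ∫⁻ t in Set.Ioi (0 : ℝ), volume {x | t < |b x|} ^ (1 / r) :=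
        lintegral_const_mul _ (hanti.measurable.pow_const _)
    _ ≤ ENNReal.ofReal r * M * (embeddingConst r q * lorentzNorm r q b) := by
        gcongr
        exact lintegral_volume_rpow_le_lorentzNorm hpr.symm.pos hq hq1 b
    _ = _ := by ring

/-- Dominated convergence in `L^{r,q}`, for functions supported in a set of finite measure. -/
theorem tendsto_lorentzNorm_zero {n : ℕ} {r q : ℝ} (hr : 0 < r) (hq : 0 < q)
    {b : Rn n → ℝ} (hfin : volume {x | b x ≠ 0} ≠ ∞) (hb : lorentzNorm r q b ≠ ∞)
    {u : ℕ → Rn n → ℝ} (hu : ∀ k, Measurable (u k)) (hub : ∀ k x, |u k x| ≤ |b x|)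
    (hlim : ∀ x, Tendsto (fun k => u k x) atTop (𝓝 0)) :
    Tendsto (fun k => lorentzNorm r q (u k)) atTop (𝓝 0) := by
  -- Dominated convergence is used twice: here in `x` for each level `t`, then in `t`, with the
  -- integrand of `lorentzNorm r q b` as majorant.
  have hmeas : ∀ t : ℝ, 0 < t →
      Tendsto (fun k => volume {x | t < |u k x|}) atTop (𝓝 0) := by
    intro t ht
    -- The support of `b` need not be measurable; its measurable hull has the same finite measure
    -- and serves as majorant.
    set S := toMeasurable volume {x | b x ≠ 0} with hS
    have hSf : volume S ≠ ∞ := by rwa [hS, measure_toMeasurable]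
    have hms : ∀ k, MeasurableSet {x | t < |u k x|} := fun k =>
      measurableSet_lt measurable_const (hu k).abs
    have h1 := tendsto_lintegral_of_dominated_convergence (μ := volume)
      (F := fun k => {x | t < |u k x|}.indicator fun _ => (1 : ℝ≥0∞)) (f := fun _ => 0)
      (S.indicator fun _ => 1) (fun k => measurable_const.indicator (hms k))
      (fun k => Eventually.of_forall fun x => Set.indicator_le_indicator_of_subset (fun y hy =>
          subset_toMeasurable _ _ fun h0 => ?_) (by simp) x) ?_ ?_
    · simpa [lintegral_indicator_const (hms _)] using h1
    · have := hub k y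
      rw [h0, abs_zero] at this
      exact absurd (ht.trans hy) (not_lt.2 this)
    · rw [lintegral_indicator_const (measurableSet_toMeasurable _ _), one_mul]
      exact hSf
    · refine Eventually.of_forall fun x => tendsto_const_nhds.congr' ?_
      have h2 := (hlim x).abs
      rw [abs_zero] at h2
      filter_upwards [h2.eventually_lt_const ht] with k hk
      rw [Set.indicator_of_notMem]
      exact not_lt.2 hk.le
  have hr1 : ENNReal.ofReal r ^ (1 / q) ≠ 0 :=
    (ENNReal.rpow_pos (by simpa using hr) ENNReal.ofReal_ne_top).ne'
  have hr2 : ENNReal.ofReal r ^ (1 / q) ≠ ∞ :=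
    ENNReal.rpow_ne_top_of_nonneg (by positivity) ENNReal.ofReal_ne_top
  have hI : ∫⁻ t in Set.Ioi (0 : ℝ), volume {x | t < |b x|} ^ (q / r) *
      ENNReal.ofReal (t ^ q / t) ≠ ∞ := by
    intro h
    refine hb ?_
    rw [lorentzNorm, h, ENNReal.top_rpow_of_pos (by positivity), ENNReal.mul_top hr1]
  have h3 := tendsto_lintegral_of_dominated_convergence (μ := volume.restrict (Set.Ioi (0 : ℝ)))
    (F := fun k t => volume {x | t < |u k x|} ^ (q / r) * ENNReal.ofReal (t ^ q / t))
    (f := fun _ => 0) (fun t => volume {x | t < |b x|} ^ (q / r) * ENNReal.ofReal (t ^ q / t))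
    (fun k => ((antitone_volume_lt (u k)).measurable.pow_const _).mul (by fun_prop))
    (fun k => Eventually.of_forall fun t => mul_le_mul' (ENNReal.rpow_le_rpow
      (measure_mono fun x hx => lt_of_lt_of_le hx (hub k x)) (by positivity)) le_rfl) hI ?_
  · rw [lintegral_zero] at h3
    have h4 := (ENNReal.continuous_rpow_const (y := 1 / q)).continuousAt.tendsto.comp h3
    rw [ENNReal.zero_rpow_of_pos (by positivity)] at h4
    have h5 := ENNReal.Tendsto.const_mul (a := ENNReal.ofReal r ^ (1 / q)) h4 (Or.inr hr2)
    rw [mul_zero] at h5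
    exact h5
  · filter_upwards [ae_restrict_mem measurableSet_Ioi] with t ht
    have h6 := (ENNReal.continuous_rpow_const (y := q / r)).continuousAt.tendsto.comp (hmeas t ht)
    rw [ENNReal.zero_rpow_of_pos (by positivity)] at h6
    have h7 := ENNReal.Tendsto.mul_const (b := ENNReal.ofReal (t ^ q / t)) h6
      (Or.inr ENNReal.ofReal_ne_top)
    rw [zero_mul] at h7
    exact h7

/-! ### Elements of the block space -/

namespace BlockSpace

variable {n : ℕ} {α s r q : ℝ}

theorem eq_of_ae {g h : BlockSpace n α s r q} (hgh : g.toFun =ᵐ[volume] h.toFun) : g = h :=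
  Subtype.ext (AEEqFun.ext hgh)

theorem add_ae {g h : BlockSpace n α s r q} {φ ψ : Rn n → ℝ} (hg : g.toFun =ᵐ[volume] φ)
    (hh : h.toFun =ᵐ[volume] ψ) : (g + h).toFun =ᵐ[volume] fun x => φ x + ψ x :=
  (AEEqFun.coeFn_add g.toFun h.toFun).trans (hg.add hh)

theorem sub_ae {g h : BlockSpace n α s r q} {φ ψ : Rn n → ℝ} (hg : g.toFun =ᵐ[volume] φ)
    (hh : h.toFun =ᵐ[volume] ψ) : (g - h).toFun =ᵐ[volume] fun x => φ x - ψ x :=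
  (AEEqFun.coeFn_sub g.toFun h.toFun).trans (hg.sub hh)

theorem smul_ae (a : ℝ) {g : BlockSpace n α s r q} {φ : Rn n → ℝ} (hg : g.toFun =ᵐ[volume] φ) :
    (a • g).toFun =ᵐ[volume] fun x => a * φ x :=
  (AEEqFun.coeFn_smul a g.toFun).trans (hg.const_smul a)

theorem zero_ae : (0 : BlockSpace n α s r q).toFun =ᵐ[volume] fun _ => 0 :=
  AEEqFun.coeFn_zero

theorem norm_le_of_isBlockDecomposition {g : BlockSpace n α s r q} {c : ℕ → ℝ}
    {b : ℕ → Rn n → ℝ} (h : IsBlockDecomposition n α s r q g.toFun c b) : ‖g‖ ≤ ∑' k, |c k| :=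
  csInf_le (blockSums_bddBelow n α s r q _) ⟨c, b, h, rfl⟩

/-- Passes from a bound for every decomposition to one for the infimum. -/
theorem le_mul_norm {g : BlockSpace n α s r q} {x C : ℝ} (hC : 0 ≤ C)
    (h : ∀ c b, IsBlockDecomposition n α s r q g.toFun c b → x ≤ C * ∑' k, |c k|) :
    x ≤ C * ‖g‖ := by
  obtain ⟨c₀, b₀, h₀⟩ := g.mem
  rcases hC.eq_or_lt with rfl | hC
  · simpa using h c₀ b₀ h₀
  rw [← div_le_iff₀' hC]
  refine le_csInf ⟨_, c₀, b₀, h₀, rfl⟩ ?_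
  rintro _ ⟨c, b, hcb, rfl⟩
  rw [div_le_iff₀' hC]
  exact h c b hcb

theorem isBlockDecomposition_single {f : Rn n →ₘ[volume] ℝ} {b : Rn n → ℝ}
    (hb : IsBlock n α s r q b) {c : ℝ} (hf : f =ᵐ[volume] fun x => c * b x) :
    IsBlockDecomposition n α s r q f (Pi.single 0 c) (fun _ => b) where
  summable := by
    refine summable_of_ne_finset_zero (s := {0}) fun k hk => ?_
    rw [Pi.single_eq_of_ne (by simpa using hk), abs_zero]
  isBlock := fun _ _ => hb
  tendsto := by
    filter_upwards [hf] with x hx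
    rw [hx]
    refine tendsto_atTop_of_eventually_const (i₀ := 1) fun N hN => ?_
    rw [Finset.sum_eq_single_of_mem 0 (by simp; omega)]
    · simp
    · intro k _ hk
      rw [Pi.single_eq_of_ne hk, zero_mul]

theorem exists_of_isBlock {b : Rn n → ℝ} (hb : IsBlock n α s r q b) (c : ℝ) :
    ∃ g : BlockSpace n α s r q, g.toFun =ᵐ[volume] fun x => c * b x := by
  have hm : AEStronglyMeasurable (fun x => c * b x) volume :=
    (hb.1.const_mul c).aestronglyMeasurable
  exact ⟨⟨AEEqFun.mk _ hm, _, _, isBlockDecomposition_single hb (AEEqFun.coeFn_mk _ hm)⟩,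
    AEEqFun.coeFn_mk _ hm⟩

theorem norm_le_of_isBlock {b : Rn n → ℝ} (hb : IsBlock n α s r q b) {c : ℝ}
    {g : BlockSpace n α s r q} (hg : g.toFun =ᵐ[volume] fun x => c * b x) : ‖g‖ ≤ |c| := by
  refine (norm_le_of_isBlockDecomposition (isBlockDecomposition_single hb hg)).trans (le_of_eq ?_)
  rw [tsum_eq_single 0 fun k hk => by rw [Pi.single_eq_of_ne hk, abs_zero], Pi.single_eq_same]

theorem isBlock_of_le (hq : 0 < q) {φ : Rn n → ℝ} (hφ : AEMeasurable φ volume) {E : Set (Rn n)}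
    (hE : Bornology.IsBounded E) (hφE : {x | φ x ≠ 0} ⊆ E) {c : ℝ} (hc : 0 < c)
    (h : besselCap n α s E ^ (1 / Real.conjExponent r) * lorentzNorm r q φ ≤ ENNReal.ofReal c) :
    IsBlock n α s r q fun x => c⁻¹ * φ x := by
  refine ⟨hφ.const_mul _, E, hE, fun x hx => hφE (right_ne_zero_of_mul hx), ?_⟩
  rw [lorentzNorm_const_mul hq (inv_pos.2 hc), mul_left_comm]
  refine (mul_le_mul_right h _).trans (le_of_eq ?_)
  rw [← ENNReal.ofReal_mul (inv_pos.2 hc).le, inv_mul_cancel₀ hc.ne', ENNReal.ofReal_one]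

theorem exists_of_lorentzNorm_le (hq : 0 < q) {φ : Rn n → ℝ} (hφ : AEMeasurable φ volume)
    {E : Set (Rn n)} (hE : Bornology.IsBounded E) (hφE : {x | φ x ≠ 0} ⊆ E) {c : ℝ} (hc : 0 ≤ c)
    (h : besselCap n α s E ^ (1 / Real.conjExponent r) * lorentzNorm r q φ ≤ ENNReal.ofReal c) :
    ∃ g : BlockSpace n α s r q, g.toFun =ᵐ[volume] φ ∧ ‖g‖ ≤ c := by
  -- Since `c` may be 0, division by `c` is avoided: `φ` is `d` times a block for every `d > c`, and
  -- `d` then decreases to `c` for one fixed `g`.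
  have hb : ∀ d, c < d → IsBlock n α s r q fun x => d⁻¹ * φ x := fun d hd =>
    isBlock_of_le hq hφ hE hφE (hc.trans_lt hd) (h.trans (ENNReal.ofReal_le_ofReal hd.le))
  have hd' : ∀ d, c < d → φ = fun x => d * (d⁻¹ * φ x) := fun d hd => by
    funext x
    rw [mul_inv_cancel_left₀ (hc.trans_lt hd).ne']
  obtain ⟨g, hg⟩ := exists_of_isBlock (hb (c + 1) (by linarith)) (c + 1)
  rw [← hd' _ (by linarith)] at hg
  refine ⟨g, hg, le_of_forall_gt_imp_ge_of_dense fun d hd => ?_⟩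
  rw [hd' d hd] at hg
  exact (norm_le_of_isBlock (hb d hd) hg).trans_eq (abs_of_pos (hc.trans_lt hd))

/-- Keeping `E` separate from `A` lets the capacity factor stay fixed while `|A|` varies. Both
countable additivity and the lower bound for `‖L‖` need this. -/
theorem exists_of_abs_le_indicator (hα : 0 < α) (hs : 1 < s) {p : ℝ} (hpr : p.HolderConjugate r)
    (hq : 0 < q) {φ : Rn n → ℝ} (hφ : AEMeasurable φ volume) {A E : Set (Rn n)}
    (hE : Bornology.IsBounded E) (hAE : A ⊆ E) (h : ∀ x, |φ x| ≤ A.indicator (fun _ => 1) x) :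
    ∃ g : BlockSpace n α s r q, g.toFun =ᵐ[volume] φ ∧
      ‖g‖ ≤ (besselCap n α s E ^ (1 / p) * (indicatorConst r q * volume A ^ (1 / r))).toReal := by
  have hr := hpr.symm.pos
  have hp := hpr.pos
  refine exists_of_lorentzNorm_le hq hφ hE (fun x hx => hAE ?_) ENNReal.toReal_nonneg ?_
  · by_contra hxA
    have := h x
    rw [Set.indicator_of_notMem hxA] at this
    exact hx (abs_nonpos_iff.1 this)
  · rw [ENNReal.ofReal_toReal]
    · rw [show Real.conjExponent r = p from hpr.symm.conjugate_eq.symm]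
      gcongr
      exact lorentzNorm_le_of_abs_le_indicator hr hq h
    · refine ENNReal.mul_ne_top (ENNReal.rpow_ne_top_of_nonneg (by positivity)
        (besselCap_lt_top hα hs hE).ne) (ENNReal.mul_ne_top (indicatorConst_ne_top hq)
        (ENNReal.rpow_ne_top_of_nonneg (by positivity) (hE.subset hAE).measure_lt_top.ne))

theorem exists_indicator (hα : 0 < α) (hs : 1 < s) {p : ℝ} (hpr : p.HolderConjugate r)
    (hq : 0 < q) {A E : Set (Rn n)} (hA : MeasurableSet A)
    (hE : Bornology.IsBounded E) (hAE : A ⊆ E) :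
    ∃ g : BlockSpace n α s r q, g.toFun =ᵐ[volume] A.indicator (fun _ => (1 : ℝ)) ∧
      ‖g‖ ≤ (besselCap n α s E ^ (1 / p) * (indicatorConst r q * volume A ^ (1 / r))).toReal := by
  refine exists_of_abs_le_indicator hα hs hpr hq (measurable_const.indicator hA).aemeasurable hE
    hAE fun x => ?_
  rw [abs_of_nonneg (Set.indicator_nonneg (by simp) x)]

end BlockSpace

/-! ### Blocks -/

/-- As `0 * ∞ = 0`, the block inequality says nothing about the Lorentz norm when the capacity
vanishes. In that case the support is null, because capacity dominates measure. -/
theorem besselCap_ne_zero_or_ae_eq_zero {n : ℕ} {α s : ℝ} (hα : 0 < α) (hs : 1 < s)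
    {b : Rn n → ℝ} {E : Set (Rn n)} (hbE : {x | b x ≠ 0} ⊆ E) :
    besselCap n α s E ≠ 0 ∨ (b =ᵐ[volume] fun _ => 0) := by
  rcases eq_or_ne (besselCap n α s E) 0 with h | h
  · right
    have h1 : volume {x | b x ≠ 0} = 0 :=
      le_zero_iff.1 (((measure_mono hbE).trans (volume_le_besselCap hα hs E)).trans_eq h)
    exact h1
  · exact Or.inl h

theorem lorentzNorm_zero {n : ℕ} {r q : ℝ} (hr : 0 < r) (hq : 0 < q) :
    lorentzNorm (n := n) r q (fun _ => 0) = 0 := by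
  have := lorentzNorm_le_of_abs_le_indicator (n := n) hr hq (φ := fun _ => 0) (A := ∅) (by simp)
  simpa [hr] using this

/-- Blocks may be taken measurable. -/
theorem IsBlock.exists_measurable {n : ℕ} {α s r q : ℝ} {b : Rn n → ℝ}
    (hb : IsBlock n α s r q b) :
    ∃ b', Measurable b' ∧ b =ᵐ[volume] b' ∧ IsBlock n α s r q b' := by
  obtain ⟨hm, E, hE, hbE, hcap⟩ := hb
  have hS : NullMeasurableSet {x | b x ≠ 0} volume :=
    (hm.nullMeasurable (measurableSet_singleton 0)).compl
  -- A measurable representative of `b` could be nonzero outside `E`; cutting it off to a measurable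
  -- `T` inside the support of `b` prevents this.
  obtain ⟨T, hTS, hT, hTe⟩ := hS.exists_measurable_subset_ae_eq
  have hae : b =ᵐ[volume] T.indicator (hm.mk b) := by
    filter_upwards [hm.ae_eq_mk, hTe.mem_iff] with x hx hxT
    by_cases hxm : x ∈ T
    · rw [Set.indicator_of_mem hxm, hx]
    · rw [Set.indicator_of_notMem hxm]
      by_contra h0
      exact hxm (hxT.2 h0)
  refine ⟨T.indicator (hm.mk b), hm.measurable_mk.indicator hT, hae,
    (hm.measurable_mk.indicator hT).aemeasurable, E, hE, fun x hx => ?_, ?_⟩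
  · exact hbE (hTS (Set.mem_of_indicator_ne_zero hx))
  · rwa [← lorentzNorm_congr hae]

/-! ### Multipliers as functionals -/

/-- The multiplier norm tests compact sets only, while blocks live on arbitrary bounded sets. Inner
regularity of Lebesgue measure and monotonicity of capacity bridge the gap. -/
theorem mul_volume_rpow_le_weakMultiplierNorm {n : ℕ} {α s p : ℝ} (hα : 0 < α) (hs : 1 < s)
    (hp : 0 < p) {f : Rn n → ℝ} (hf : Measurable f) {S E : Set (Rn n)}
    (hS : NullMeasurableSet S volume) (hSE : S ⊆ E) {t : ℝ} (ht : 0 < t) :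
    ENNReal.ofReal t * volume (S ∩ {x | t < |f x|}) ^ (1 / p) ≤
      weakMultiplierNorm n α s p f * besselCap n α s E ^ (1 / p) := by
  have hft : MeasurableSet {x | t < |f x|} := measurableSet_lt measurable_const hf.abs
  obtain ⟨T, hTS, hT, hTe⟩ := (hS.inter hft.nullMeasurableSet).exists_measurable_subset_ae_eq
  set B := weakMultiplierNorm n α s p f * besselCap n α s E ^ (1 / p) with hB
  have ht0 : ENNReal.ofReal t ≠ 0 := by simpa using ht
  have key : ∀ K ⊆ T, IsCompact K → volume K ≤ (B / ENNReal.ofReal t) ^ p := by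
    intro K hKT hK
    -- Compact sets of capacity zero are excluded from the supremum, but they are null.
    rcases eq_or_ne (besselCap n α s K) 0 with h0 | h0
    · exact ((volume_le_besselCap hα hs K).trans_eq h0).trans zero_le
    rw [← ENNReal.rpow_inv_le_iff hp, ENNReal.le_div_iff_mul_le (Or.inl ht0)
      (Or.inl ENNReal.ofReal_ne_top), mul_comm, ← one_div]
    have hc0 : besselCap n α s K ^ (1 / p) ≠ 0 := by
      rw [Ne, ENNReal.rpow_eq_zero_iff_of_pos (by positivity)]
      exact h0
    have hct : besselCap n α s K ^ (1 / p) ≠ ∞ :=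
      ENNReal.rpow_ne_top_of_nonneg (by positivity) (besselCap_lt_top hα hs hK.isBounded).ne
    have h1 : weakLorentzNorm p (K.indicator f) / besselCap n α s K ^ (1 / p) ≤
        weakMultiplierNorm n α s p f := by
      unfold weakMultiplierNorm
      exact le_iSup_of_le K (le_iSup_of_le hK (le_iSup_of_le h0 le_rfl))
    rw [ENNReal.div_le_iff hc0 hct] at h1
    calc ENNReal.ofReal t * volume K ^ (1 / p)
        ≤ ENNReal.ofReal t * volume {x | t < |K.indicator f x|} ^ (1 / p) := by
          gcongr
          intro x hx
          change t < |K.indicator f x|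
          rw [Set.indicator_of_mem hx]
          exact (hTS (hKT hx)).2
      _ ≤ weakLorentzNorm p (K.indicator f) := by
          unfold weakLorentzNorm
          exact le_iSup_of_le t (le_iSup_of_le ht le_rfl)
      _ ≤ _ := h1
      _ ≤ B := by
          rw [hB]
          gcongr
          exact besselCap_mono ((hKT.trans hTS).trans (Set.inter_subset_left.trans hSE))
  have h2 : volume T ≤ (B / ENNReal.ofReal t) ^ p := by
    rw [hT.measure_eq_iSup_isCompact]
    exact iSup_le fun K => iSup_le fun hKT => iSup_le fun hK => key K hKT hK
  rw [← hTe.measure_eq, mul_comm]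
  rwa [← ENNReal.rpow_inv_le_iff hp, ENNReal.le_div_iff_mul_le (Or.inl ht0)
      (Or.inl ENNReal.ofReal_ne_top), ← one_div] at h2

/-- The constant in the pairing of `𝓑^{r,q}` with `𝓜^{p,∞}`. -/
noncomputable def pairingConst (r q : ℝ) : ℝ≥0∞ := ENNReal.ofReal r * embeddingConst r q

theorem pairingConst_ne_top {r q : ℝ} (hr : 0 < r) (hq : 0 < q) (hq1 : q ≤ 1) :
    pairingConst r q ≠ ∞ :=
  ENNReal.mul_ne_top ENNReal.ofReal_ne_top (embeddingConst_ne_top hr hq hq1)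

/-- Hölder with weak-type constant `‖f‖_𝓜 Cap(E)^(1/p)`; the normalization of the block absorbs the
capacity. -/
theorem IsBlock.lintegral_enorm_mul_le {n : ℕ} {α s p r q : ℝ} (hα : 0 < α) (hs : 1 < s)
    (hpr : p.HolderConjugate r) (hq : 0 < q) (hq1 : q ≤ 1) {f b : Rn n → ℝ} (hf : Measurable f)
    (hb : IsBlock n α s r q b) :
    ∫⁻ x, ‖f x‖ₑ * ‖b x‖ₑ ≤ pairingConst r q * weakMultiplierNorm n α s p f := by
  obtain ⟨hm, E, hE, hbE, hcap⟩ := hb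
  rw [show Real.conjExponent r = p from hpr.symm.conjugate_eq.symm] at hcap
  have hS : NullMeasurableSet {x | b x ≠ 0} volume :=
    (hm.nullMeasurable (measurableSet_singleton 0)).compl
  refine (lintegral_enorm_mul_le_of_weak hpr hq hq1 hf hm (hE.subset hbE).measure_lt_top.ne
    fun t ht => mul_volume_rpow_le_weakMultiplierNorm (α := α) (s := s) hα hs hpr.pos hf hS hbE ht).trans ?_
  unfold pairingConst
  gcongr
  rw [mul_assoc]
  exact mul_le_of_le_one_right' hcap

theorem lintegral_enorm_mul_le_tsum {n : ℕ} {α s p r q : ℝ} (hα : 0 < α) (hs : 1 < s)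
    (hpr : p.HolderConjugate r) (hq : 0 < q) (hq1 : q ≤ 1) {f : Rn n → ℝ} (hf : Measurable f)
    {g : Rn n →ₘ[volume] ℝ} {c : ℕ → ℝ} {b : ℕ → Rn n → ℝ}
    (h : IsBlockDecomposition n α s r q g c b) :
    ∫⁻ x, ‖g x * f x‖ₑ ≤ pairingConst r q * weakMultiplierNorm n α s p f *
      ENNReal.ofReal (∑' k, |c k|) := by
  -- When `c k = 0` nothing is known about `b k`, not even measurability.
  have hu : ∀ k, AEMeasurable (fun x => c k * b k x) volume := fun k => by
    by_cases hk : c k = 0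
    · simp [hk]
    · exact (h.isBlock k hk).1.const_mul _
  have h1 : ∀ᵐ x, ‖g x * f x‖ₑ ≤ ∑' k, ‖f x‖ₑ * ‖c k * b k x‖ₑ := by
    filter_upwards [h.tendsto] with x hx
    rw [enorm_mul, mul_comm, ENNReal.tsum_mul_left]
    gcongr
    refine le_of_tendsto' hx.enorm fun N => (enorm_sum_le _ _).trans ?_
    exact ENNReal.sum_le_tsum _
  refine (lintegral_mono_ae h1).trans ?_
  have hfu : ∀ k, AEMeasurable (fun x => ‖f x‖ₑ * ‖c k * b k x‖ₑ) volume := fun k =>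
    hf.enorm.aemeasurable.mul (hu k).enorm
  rw [lintegral_tsum hfu,
    ENNReal.ofReal_tsum_of_nonneg (fun k => abs_nonneg _) h.summable, ← ENNReal.tsum_mul_left]
  refine ENNReal.tsum_le_tsum fun k => ?_
  by_cases hk : c k = 0
  · simp [hk]
  simp_rw [enorm_mul, mul_left_comm _ ‖c k‖ₑ]
  rw [lintegral_const_mul' _ _ enorm_ne_top, mul_comm, ← Real.norm_eq_abs, ofReal_norm]
  gcongr
  exact (h.isBlock k hk).lintegral_enorm_mul_le hα hs hpr hq hq1 hf

theorem integrable_mul_of_weakMultiplierNorm_lt_top {n : ℕ} {α s p r q : ℝ} (hα : 0 < α)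
    (hs : 1 < s) (hpr : p.HolderConjugate r) (hq : 0 < q) (hq1 : q ≤ 1) {f : Rn n → ℝ}
    (hf : Measurable f) (hfM : weakMultiplierNorm n α s p f < ∞) (g : BlockSpace n α s r q) :
    Integrable (fun x => g.toFun x * f x) := by
  obtain ⟨c, b, h⟩ := g.mem
  refine ⟨(g.toFun.aestronglyMeasurable.mul hf.aestronglyMeasurable), ?_⟩
  refine (lintegral_enorm_mul_le_tsum hα hs hpr hq hq1 hf h).trans_lt ?_
  exact ENNReal.mul_lt_top (ENNReal.mul_lt_top
    (pairingConst_ne_top hpr.symm.pos hq hq1).lt_top hfM) ENNReal.ofReal_lt_top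

theorem norm_integral_mul_le {n : ℕ} {α s p r q : ℝ} (hα : 0 < α)
    (hs : 1 < s) (hpr : p.HolderConjugate r) (hq : 0 < q) (hq1 : q ≤ 1) {f : Rn n → ℝ}
    (hf : Measurable f) (hfM : weakMultiplierNorm n α s p f < ∞) (g : BlockSpace n α s r q) :
    ‖∫ x, g.toFun x * f x‖ ≤
      (pairingConst r q).toReal * (weakMultiplierNorm n α s p f).toReal * ‖g‖ := by
  have hC := (pairingConst_ne_top hpr.symm.pos hq hq1)
  refine BlockSpace.le_mul_norm (by positivity) fun c b h => ?_
  have hsum : 0 ≤ ∑' k, |c k| := tsum_nonneg fun k => abs_nonneg _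
  have h1 := (enorm_integral_le_lintegral_enorm _).trans
    (lintegral_enorm_mul_le_tsum hα hs hpr hq hq1 hf h)
  have h2 := ENNReal.toReal_mono (ENNReal.mul_ne_top (ENNReal.mul_ne_top hC hfM.ne)
    ENNReal.ofReal_ne_top) h1
  rwa [toReal_enorm, ENNReal.toReal_mul, ENNReal.toReal_mul, ENNReal.toReal_ofReal hsum] at h2

theorem exists_isRepresentedBy {n : ℕ} {α s p r q : ℝ} (hα : 0 < α)
    (hs : 1 < s) (hpr : p.HolderConjugate r) (hq : 0 < q) (hq1 : q ≤ 1) {f : Rn n →ₘ[volume] ℝ}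
    (hfM : f ∈ weakMultiplierSpace n α s p) :
    ∃ L : StrongDual ℝ (BlockSpace n α s r q), IsRepresentedBy L f := by
  have hf : Measurable f := f.measurable
  have hint := integrable_mul_of_weakMultiplierNorm_lt_top (q := q) hα hs hpr hq hq1 hf hfM
  refine ⟨LinearMap.mkContinuous
    { toFun := fun g => ∫ x, g.toFun x * f x
      map_add' := fun g h => ?_
      map_smul' := fun a g => ?_ }
    ((pairingConst r q).toReal * (weakMultiplierNorm n α s p f).toReal)
    fun g => norm_integral_mul_le hα hs hpr hq hq1 hf hfM g, fun g => ⟨hint g, rfl⟩⟩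
  · rw [← integral_add (hint g) (hint h)]
    refine integral_congr_ae ?_
    filter_upwards [BlockSpace.add_ae (EventuallyEq.refl _ g.toFun) (EventuallyEq.refl _ h.toFun)]
      with x hx
    rw [hx, add_mul]
  · rw [RingHom.id_apply, smul_eq_mul, ← integral_const_mul]
    refine integral_congr_ae ?_
    filter_upwards [BlockSpace.smul_ae a (EventuallyEq.refl _ g.toFun)] with x hx
    rw [hx, mul_assoc]

theorem IsRepresentedBy.norm_le {n : ℕ} {α s p r q : ℝ} (hα : 0 < α)
    (hs : 1 < s) (hpr : p.HolderConjugate r) (hq : 0 < q) (hq1 : q ≤ 1)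
    {L : StrongDual ℝ (BlockSpace n α s r q)} {f : Rn n →ₘ[volume] ℝ}
    (hfM : f ∈ weakMultiplierSpace n α s p) (h : IsRepresentedBy L f) :
    ‖L‖ ≤ (pairingConst r q).toReal * (weakMultiplierNorm n α s p f).toReal :=
  L.opNorm_le_bound (by positivity) fun g => by
    rw [(h g).2]
    exact norm_integral_mul_le hα hs hpr hq hq1 f.measurable hfM g

/-! ### Functionals are determined by their values on indicators -/

/-- To be applied to the difference of two functionals that agree on indicators. -/
theorem exists_simpleFunc_map_eq_zero {n : ℕ} {α s p r q : ℝ} (hα : 0 < α) (hs : 1 < s)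
    (hpr : p.HolderConjugate r) (hq : 0 < q) (D : StrongDual ℝ (BlockSpace n α s r q))
    (hD : ∀ A : Set (Rn n), MeasurableSet A → Bornology.IsBounded A → ∀ g : BlockSpace n α s r q,
      g.toFun =ᵐ[volume] A.indicator (fun _ => (1 : ℝ)) → D g = 0)
    (u : SimpleFunc (Rn n) ℝ) (hu : Bornology.IsBounded (Function.support u)) :
    ∃ g : BlockSpace n α s r q, g.toFun =ᵐ[volume] u ∧ D g = 0 := by
  induction u using SimpleFunc.induction with
  | @const a A hA =>
    rcases eq_or_ne a 0 with rfl | ha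
    · refine ⟨0, BlockSpace.zero_ae.trans (Eventually.of_forall fun x => ?_), map_zero D⟩
      simp
    · have hAb : Bornology.IsBounded A := hu.subset fun x hx => by
        simp [hx, ha]
      obtain ⟨g, hg, -⟩ := BlockSpace.exists_indicator (α := α) (s := s) hα hs hpr hq hA hAb
        subset_rfl
      refine ⟨a • g, (BlockSpace.smul_ae a hg).trans (Eventually.of_forall fun x => ?_), ?_⟩
      · by_cases hx : x ∈ A <;> simp [Set.piecewise, hx]
      · rw [map_smul, hD A hA hAb g hg, smul_zero]
  | @add u v huv ihu ihv =>
    -- Disjointness of the supports rules out cancellation, so each summand inherits a bounded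
    -- support.
    obtain ⟨g, hg, hg0⟩ := ihu (hu.subset fun x hx => by
      have hv : v x = 0 := Function.notMem_support.1 (Set.disjoint_left.1 huv hx)
      rwa [Function.mem_support, SimpleFunc.coe_add, Pi.add_apply, hv, add_zero])
    obtain ⟨h, hh, hh0⟩ := ihv (hu.subset fun x hx => by
      have hu : u x = 0 := Function.notMem_support.1 (Set.disjoint_right.1 huv hx)
      rwa [Function.mem_support, SimpleFunc.coe_add, Pi.add_apply, hu, zero_add])
    exact ⟨g + h, BlockSpace.add_ae hg hh, by rw [map_add, hg0, hh0, add_zero]⟩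

/-- Simple functions `u k → b` with `|b - u k| ≤ |b|` leave errors supported in the same `E`.
Dominated convergence makes their Lorentz norms, hence their block norms, tend to 0, and `D` kills
each `u k`. -/
theorem IsBlock.map_eq_zero {n : ℕ} {α s p r q : ℝ} (hα : 0 < α) (hs : 1 < s)
    (hpr : p.HolderConjugate r) (hq : 0 < q) (D : StrongDual ℝ (BlockSpace n α s r q))
    (hD : ∀ A : Set (Rn n), MeasurableSet A → Bornology.IsBounded A → ∀ g : BlockSpace n α s r q,
      g.toFun =ᵐ[volume] A.indicator (fun _ => (1 : ℝ)) → D g = 0)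
    {b : Rn n → ℝ} (hb : IsBlock n α s r q b) {g : BlockSpace n α s r q}
    (hg : g.toFun =ᵐ[volume] b) : D g = 0 := by
  obtain ⟨b', hb'm, hbb', hb'⟩ := hb.exists_measurable
  replace hg := hg.trans hbb'
  clear hbb' hb
  have hr := hpr.symm.pos
  obtain ⟨-, E, hE, hbE, hcap⟩ := hb'
  rw [show Real.conjExponent r = p from hpr.symm.conjugate_eq.symm] at hcap
  have hp := hpr.pos
  have hfin : lorentzNorm r q b' ≠ ∞ := by
    rcases besselCap_ne_zero_or_ae_eq_zero hα hs hbE with h | h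
    · intro h'
      rw [h', ENNReal.mul_top] at hcap
      · exact absurd hcap (by simp)
      · rw [Ne, ENNReal.rpow_eq_zero_iff_of_pos (by positivity)]
        exact h
    · rw [lorentzNorm_congr h, lorentzNorm_zero hr hq]
      exact ENNReal.zero_ne_top
  set u : ℕ → SimpleFunc (Rn n) ℝ := SimpleFunc.approxOn b' hb'm Set.univ 0 (Set.mem_univ _)
    with hu
  -- The approximation starts from the value 0, so `u k x` is never farther from `b' x` than 0 is.
  have hdist : ∀ k x, |b' x - u k x| ≤ |b' x| := fun k x => by
    have h1 := SimpleFunc.edist_approxOn_le hb'm (Set.mem_univ (0 : ℝ)) x k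
    rw [edist_dist, edist_dist, ENNReal.ofReal_le_ofReal_iff dist_nonneg, dist_comm, dist_comm 0,
      dist_zero_right, Real.dist_eq, Real.norm_eq_abs] at h1
    exact h1
  have hlim : Tendsto (fun k => besselCap n α s E ^ (1 / p) *
      lorentzNorm r q (fun x => b' x - u k x)) atTop (𝓝 0) := by
    have h1 := tendsto_lorentzNorm_zero hr hq (hE.subset hbE).measure_lt_top.ne hfin
      (u := fun k x => b' x - u k x) (fun k => hb'm.sub (u k).measurable) hdist fun x => by
        have h2 := SimpleFunc.tendsto_approxOn hb'm (Set.mem_univ (0 : ℝ)) (x := x) (by simp)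
        simpa using h2.const_sub (b' x)
    have h3 := ENNReal.Tendsto.const_mul (a := besselCap n α s E ^ (1 / p)) h1
      (Or.inr (ENNReal.rpow_ne_top_of_nonneg (by positivity) (besselCap_lt_top hα hs hE).ne))
    rwa [mul_zero] at h3
  have hsup : ∀ k, {x | b' x - u k x ≠ 0} ⊆ E := fun k x hx => hbE fun h0 => hx <| by
    have := hdist k x
    rw [h0, abs_zero] at this
    rw [h0]
    exact abs_nonpos_iff.1 this
  have hbound : ∀ ε : ℝ, 0 < ε → ‖D g‖ ≤ ‖D‖ * ε := by
    intro ε hε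
    obtain ⟨k, hk⟩ := (hlim.eventually_le_const (ENNReal.ofReal_pos.2 hε)).exists
    obtain ⟨v, hv, hv0⟩ := exists_simpleFunc_map_eq_zero hα hs hpr hq D hD (u k)
      (hE.subset fun x hx => by
        by_contra hxE
        have h0 : b' x = 0 := by
          by_contra h0
          exact hxE (hbE h0)
        have := hdist k x
        rw [h0, abs_zero, zero_sub, abs_neg] at this
        exact hx (abs_nonpos_iff.1 this))
    rw [← show Real.conjExponent r = p from hpr.symm.conjugate_eq.symm] at hk
    obtain ⟨w, hw, hwε⟩ := BlockSpace.exists_of_lorentzNorm_le hq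
      (hb'm.sub (u k).measurable).aemeasurable hE (hsup k) hε.le hk
    have hgw : g - v = w := BlockSpace.eq_of_ae ((BlockSpace.sub_ae hg hv).trans hw.symm)
    have : D g = D w := by rw [← hgw, map_sub, hv0, sub_zero]
    rw [this]
    exact (D.le_opNorm w).trans (by gcongr)
  refine norm_le_zero_iff.1 (le_of_forall_pos_le_add fun ε hε => ?_)
  refine (hbound (ε / (‖D‖ + 1)) (by positivity)).trans ?_
  rw [zero_add, mul_div_assoc', div_le_iff₀ (by positivity)]
  nlinarith [norm_nonneg D]

theorem IsBlockDecomposition.sub_head {n : ℕ} {α s r q : ℝ} {f u : Rn n →ₘ[volume] ℝ}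
    {c : ℕ → ℝ} {b : ℕ → Rn n → ℝ} (h : IsBlockDecomposition n α s r q f c b)
    (hu : u =ᵐ[volume] fun x => c 0 * b 0 x) :
    IsBlockDecomposition n α s r q (f - u) (fun k => c (k + 1)) (fun k => b (k + 1)) where
  summable := (summable_nat_add_iff 1).2 h.summable
  isBlock := fun k hk => h.isBlock _ hk
  tendsto := by
    filter_upwards [h.tendsto, hu, AEEqFun.coeFn_sub f u] with x h1 h2 h3
    rw [h3, Pi.sub_apply, h2]
    refine ((h1.comp (tendsto_add_atTop_nat 1)).sub_const _).congr fun N => ?_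
    simp only [Function.comp, Finset.sum_range_succ']
    ring

/-- Decompositions converge only almost everywhere by definition, yet they converge in norm: the
remainder after `N` terms is decomposed by the tail, so its norm is at most `∑ |c (k + N)|`. As `D`
kills every block, `D g` equals `D` of each remainder. -/
theorem strongDual_eq_zero {n : ℕ} {α s p r q : ℝ} (hα : 0 < α) (hs : 1 < s)
    (hpr : p.HolderConjugate r) (hq : 0 < q) (D : StrongDual ℝ (BlockSpace n α s r q))
    (hD : ∀ A : Set (Rn n), MeasurableSet A → Bornology.IsBounded A → ∀ g : BlockSpace n α s r q,
      g.toFun =ᵐ[volume] A.indicator (fun _ => (1 : ℝ)) → D g = 0)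
    (g : BlockSpace n α s r q) : D g = 0 := by
  obtain ⟨c, b, hcb⟩ := g.mem
  have key : ∀ N : ℕ, ∃ h : BlockSpace n α s r q, D h = D g ∧
      IsBlockDecomposition n α s r q h.toFun (fun k => c (k + N)) (fun k => b (k + N)) := by
    intro N
    induction N with
    | zero => exact ⟨g, rfl, hcb⟩
    | succ N ih =>
      obtain ⟨h, hh, hdec⟩ := ih
      obtain ⟨u, hu, hu0⟩ : ∃ u : BlockSpace n α s r q,
          (u.toFun =ᵐ[volume] fun x => c (0 + N) * b (0 + N) x) ∧ D u = 0 := by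
        by_cases hc : c (0 + N) = 0
        · refine ⟨0, ?_, map_zero D⟩
          simp only [hc, zero_mul]
          exact BlockSpace.zero_ae
        · obtain ⟨v, hv⟩ := BlockSpace.exists_of_isBlock (hcb.isBlock _ hc) 1
          refine ⟨c (0 + N) • v, ?_, ?_⟩
          · simpa using BlockSpace.smul_ae (c (0 + N)) hv
          · rw [map_smul, (hcb.isBlock _ hc).map_eq_zero hα hs hpr hq D hD (by simpa using hv),
              smul_zero]
      refine ⟨h - u, by rw [map_sub, hu0, sub_zero, hh], ?_⟩
      have := hdec.sub_head hu
      simp only [add_assoc, add_comm 1 N] at this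
      exact this
  have hle : ∀ N : ℕ, ‖D g‖ ≤ ‖D‖ * ∑' k, |c (k + N)| := fun N => by
    obtain ⟨h, hh, hdec⟩ := key N
    rw [← hh]
    exact (D.le_opNorm h).trans (by
      gcongr
      exact BlockSpace.norm_le_of_isBlockDecomposition hdec)
  have h0 := (tendsto_sum_nat_add fun k => |c k|).const_mul ‖D‖
  rw [mul_zero] at h0
  exact norm_le_zero_iff.1 (ge_of_tendsto' h0 hle)

/-! ### Lower bound for the norm of a functional -/

/-- `L` is given by integration against `f` on indicators of bounded measurable sets. -/
def RepresentsIndicators {n : ℕ} {α s r q : ℝ} (L : StrongDual ℝ (BlockSpace n α s r q))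
    (f : Rn n → ℝ) : Prop :=
  ∀ A : Set (Rn n), MeasurableSet A → Bornology.IsBounded A →
    IntegrableOn f A ∧ ∀ g : BlockSpace n α s r q,
      g.toFun =ᵐ[volume] A.indicator (fun _ => (1 : ℝ)) → L g = ∫ x in A, f x

theorem indicator_one_mul_ae {n : ℕ} {α s r q : ℝ} {A : Set (Rn n)} {f : Rn n → ℝ}
    {g : BlockSpace n α s r q} (hg : g.toFun =ᵐ[volume] A.indicator (fun _ => (1 : ℝ))) :
    (fun x => g.toFun x * f x) =ᵐ[volume] A.indicator f := by
  filter_upwards [hg] with x hx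
  rw [hx]
  by_cases h : x ∈ A <;> simp [h]

theorem IsRepresentedBy.representsIndicators {n : ℕ} {α s p r q : ℝ} (hα : 0 < α) (hs : 1 < s)
    (hpr : p.HolderConjugate r) (hq : 0 < q) {L : StrongDual ℝ (BlockSpace n α s r q)}
    {f : Rn n →ₘ[volume] ℝ} (h : IsRepresentedBy L f) : RepresentsIndicators L f := by
  refine fun A hA hAb => ⟨?_, fun g hg => ?_⟩
  · obtain ⟨g, hg, -⟩ := BlockSpace.exists_indicator (α := α) (s := s) hα hs hpr hq hA hAb
      subset_rfl
    rw [← integrable_indicator_iff hA]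
    exact (h g).1.congr (indicator_one_mul_ae hg)
  · rw [(h g).2, integral_congr_ae (indicator_one_mul_ae hg), integral_indicator hA]

/-- Tests `L` on the sign of `f` over `K ∩ {|f| > t}`, where the integral of `|f|` is at least `t`
times the measure. -/
theorem RepresentsIndicators.mul_measureReal_le {n : ℕ} {α s p r q : ℝ} (hα : 0 < α)
    (hs : 1 < s) (hpr : p.HolderConjugate r) (hq : 0 < q)
    {L : StrongDual ℝ (BlockSpace n α s r q)} {f : Rn n → ℝ} (hf : Measurable f)
    (h : RepresentsIndicators L f) {K : Set (Rn n)} (hK : MeasurableSet K)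
    (hKb : Bornology.IsBounded K) {t : ℝ} (ht : 0 < t) :
    t * volume.real (K ∩ {x | t < |f x|}) ≤ ‖L‖ * (besselCap n α s K ^ (1 / p) *
      (indicatorConst r q * volume (K ∩ {x | t < |f x|}) ^ (1 / r))).toReal := by
  set P := K ∩ {x | t < f x} with hP
  set Q := K ∩ {x | f x < -t} with hQ
  have hPm : MeasurableSet P := hK.inter (measurableSet_lt measurable_const hf)
  have hQm : MeasurableSet Q := hK.inter (measurableSet_lt hf measurable_const)
  have hPK : P ⊆ K := Set.inter_subset_left
  have hQK : Q ⊆ K := Set.inter_subset_left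
  have hA : K ∩ {x | t < |f x|} = P ∪ Q := by
    rw [hP, hQ, ← Set.inter_union_distrib_left]
    congr 1
    ext x
    exact (lt_abs (a := t) (b := f x)).trans (or_congr_right lt_neg)
  have hPQ : Disjoint P Q := Set.disjoint_left.2 fun x h1 h2 => by
    have h3 : t < f x := h1.2
    have h4 : f x < -t := h2.2
    linarith
  have hPf : volume P ≠ ∞ := (hKb.subset hPK).measure_lt_top.ne
  have hQf : volume Q ≠ ∞ := (hKb.subset hQK).measure_lt_top.ne
  obtain ⟨hPi, hPL⟩ := h P hPm (hKb.subset hPK)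
  obtain ⟨hQi, hQL⟩ := h Q hQm (hKb.subset hQK)
  obtain ⟨g, hg, -⟩ := BlockSpace.exists_indicator (α := α) (s := s) hα hs hpr hq hPm hKb hPK
  obtain ⟨k, hk, -⟩ := BlockSpace.exists_indicator (α := α) (s := s) hα hs hpr hq hQm hKb hQK
  -- The difference is estimated as one function bounded by the indicator of `P ∪ Q`, not as two
  -- separate blocks.
  obtain ⟨w, hw, hwn⟩ := BlockSpace.exists_of_abs_le_indicator (α := α) (s := s) hα hs hpr hq
    (φ := fun x => P.indicator (fun _ => (1 : ℝ)) x - Q.indicator (fun _ => (1 : ℝ)) x)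
    ((measurable_const.indicator hPm).sub (measurable_const.indicator hQm)).aemeasurable hKb
    (Set.union_subset hPK hQK) fun x => by
      by_cases h1 : x ∈ P
      · simp [h1, Set.disjoint_left.1 hPQ h1]
      · by_cases h2 : x ∈ Q <;> simp [h1, h2]
  have hgk : g - k = w := BlockSpace.eq_of_ae ((BlockSpace.sub_ae hg hk).trans hw.symm)
  have h1 : t * volume.real P ≤ ∫ x in P, f x :=
    setIntegral_ge_of_const_le_real hPm hPf (fun x hx => le_of_lt hx.2) hPi
  have h2 : t * volume.real Q ≤ ∫ x in Q, -f x :=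
    setIntegral_ge_of_const_le_real hQm hQf
      (fun x hx => le_of_lt (lt_neg.1 hx.2)) hQi.neg
  rw [integral_neg] at h2
  have h3 : L w = (∫ x in P, f x) - ∫ x in Q, f x := by
    rw [← hgk, map_sub, hPL g hg, hQL k hk]
  rw [hA, measureReal_union hPQ hQm hPf hQf]
  calc t * (volume.real P + volume.real Q) ≤ L w := by rw [h3]; linarith
    _ ≤ ‖L w‖ := Real.le_norm_self _
    _ ≤ ‖L‖ * ‖w‖ := L.le_opNorm w
    _ ≤ _ := by gcongr

/-- Since `1/p + 1/r = 1`, dividing the preceding estimate by `|A|^(1/r)` turns `t |A|` into `t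
|A|^(1/p)`. -/
theorem RepresentsIndicators.weakMultiplierNorm_le {n : ℕ} {α s p r q : ℝ} (hα : 0 < α)
    (hs : 1 < s) (hpr : p.HolderConjugate r) (hq : 0 < q)
    {L : StrongDual ℝ (BlockSpace n α s r q)} {f : Rn n → ℝ} (hf : Measurable f)
    (h : RepresentsIndicators L f) :
    weakMultiplierNorm n α s p f ≤ indicatorConst r q * ENNReal.ofReal ‖L‖ := by
  have hp := hpr.pos
  have hr := hpr.symm.pos
  refine iSup_le fun K => iSup_le fun hK => iSup_le fun hK0 => ?_
  have hKb := hK.isBounded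
  have hc0 : besselCap n α s K ^ (1 / p) ≠ 0 := by
    rw [Ne, ENNReal.rpow_eq_zero_iff_of_pos (by positivity)]
    exact hK0
  have hct : besselCap n α s K ^ (1 / p) ≠ ∞ :=
    ENNReal.rpow_ne_top_of_nonneg (by positivity) (besselCap_lt_top hα hs hKb).ne
  rw [ENNReal.div_le_iff hc0 hct]
  refine iSup_le fun t => iSup_le fun ht => ?_
  have hset : {x | t < |K.indicator f x|} = K ∩ {x | t < |f x|} := by
    ext x
    by_cases hx : x ∈ K
    · simp [hx]
    · simp [hx, ht.le]
  rw [hset]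
  have hfin : volume (K ∩ {x | t < |f x|}) ≠ ∞ :=
    (hKb.subset Set.inter_subset_left).measure_lt_top.ne
  have key := h.mul_measureReal_le hα hs hpr hq hf hK.measurableSet hKb ht
  set A := K ∩ {x | t < |f x|} with hA
  rcases eq_or_ne (volume A) 0 with h0 | h0
  · rw [h0, ENNReal.zero_rpow_of_pos (by positivity), mul_zero]
    exact zero_le
  have hv0 : volume A ^ (1 / r) ≠ 0 := (ENNReal.rpow_pos (pos_iff_ne_zero.2 h0) hfin).ne'
  have hvt : volume A ^ (1 / r) ≠ ∞ := ENNReal.rpow_ne_top_of_nonneg (by positivity) hfin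
  have hkey := ENNReal.ofReal_le_ofReal key
  rw [ENNReal.ofReal_mul ht.le, ENNReal.ofReal_mul (norm_nonneg _), ofReal_measureReal hfin,
    ENNReal.ofReal_toReal (ENNReal.mul_ne_top hct (ENNReal.mul_ne_top (indicatorConst_ne_top hq)
      hvt))] at hkey
  have hsplit : volume A = volume A ^ (1 / p) * volume A ^ (1 / r) := by
    rw [← ENNReal.rpow_add _ _ h0 hfin, one_div, one_div, hpr.inv_add_inv_eq_one, ENNReal.rpow_one]
  rw [← ENNReal.mul_le_mul_iff_left hv0 hvt]
  calc ENNReal.ofReal t * volume A ^ (1 / p) * volume A ^ (1 / r)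
      = ENNReal.ofReal t * volume A := by rw [mul_assoc, ← hsplit]
    _ ≤ _ := hkey
    _ = _ := by ring

/-! ### Existence of the representing function -/

/-- Radon–Nikodym for the signed measure `A ↦ L(χ_{A ∩ S})`. Intersecting with the bounded `S` makes
it defined on all measurable sets. -/
theorem exists_setIntegral_eq {n : ℕ} {α s p r q : ℝ} (hα : 0 < α) (hs : 1 < s)
    (hpr : p.HolderConjugate r) (hq : 0 < q) (L : StrongDual ℝ (BlockSpace n α s r q))
    {S : Set (Rn n)} (hS : MeasurableSet S) (hSb : Bornology.IsBounded S) :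
    ∃ f : Rn n → ℝ, Measurable f ∧ Integrable f ∧ ∀ A ⊆ S, MeasurableSet A →
      ∀ g : BlockSpace n α s r q, g.toFun =ᵐ[volume] A.indicator (fun _ => (1 : ℝ)) →
        L g = ∫ x in A, f x := by
  classical
  have hr := hpr.symm.pos
  have hp := hpr.pos
  have hex : ∀ A : Set (Rn n), ∃ g : BlockSpace n α s r q, MeasurableSet A →
      g.toFun =ᵐ[volume] (A ∩ S).indicator (fun _ => (1 : ℝ)) ∧
        ‖g‖ ≤ (besselCap n α s S ^ (1 / p) *
          (indicatorConst r q * volume (A ∩ S) ^ (1 / r))).toReal := by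
    intro A
    by_cases hA : MeasurableSet A
    · obtain ⟨g, hg⟩ := BlockSpace.exists_indicator (α := α) (s := s) hα hs hpr hq
        (hA.inter hS) hSb Set.inter_subset_right
      exact ⟨g, fun _ => hg⟩
    · exact ⟨0, fun h => absurd h hA⟩
  choose χ hχ using hex
  have hzero : ∀ A, MeasurableSet A → volume A = 0 → χ A = 0 := fun A hA h0 => by
    refine BlockSpace.eq_of_ae ((hχ A hA).1.trans (EventuallyEq.trans ?_ BlockSpace.zero_ae.symm))
    have : volume (A ∩ S) = 0 := measure_mono_null Set.inter_subset_left h0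
    filter_upwards [measure_eq_zero_iff_ae_notMem.1 this] with x hx
    rw [Set.indicator_of_notMem hx]
  have hunion : ∀ A B, MeasurableSet A → MeasurableSet B → Disjoint A B →
      χ (A ∪ B) = χ A + χ B := fun A B hA hB hAB => by
    refine BlockSpace.eq_of_ae ((hχ _ (hA.union hB)).1.trans (EventuallyEq.trans ?_
      (BlockSpace.add_ae (hχ A hA).1 (hχ B hB).1).symm))
    rw [Set.union_inter_distrib_right, Set.indicator_union_of_disjoint
      (hAB.mono Set.inter_subset_left Set.inter_subset_left)]
  let ν : SignedMeasure (Rn n) :=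
    { measureOf' := fun A => if MeasurableSet A then L (χ A) else 0
      empty' := by rw [if_pos MeasurableSet.empty, hzero ∅ MeasurableSet.empty measure_empty,
        map_zero]
      not_measurable' := fun A hA => if_neg hA
      m_iUnion' := fun A hA hdis => by
        have hfin : ∀ F : Finset ℕ, MeasurableSet (⋃ i ∈ F, A i) := fun F =>
          F.measurableSet_biUnion fun i _ => hA i
        have hco : ∀ F : Finset ℕ, MeasurableSet (⋃ i : {i // i ∉ F}, A i) := fun F =>
          MeasurableSet.iUnion fun i => hA i
        have hsum : ∀ F : Finset ℕ, χ (⋃ i ∈ F, A i) = ∑ i ∈ F, χ (A i) := by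
          intro F
          induction F using Finset.induction_on with
          | empty => simpa using hzero ∅ MeasurableSet.empty measure_empty
          | insert j F hj ih =>
            rw [Finset.set_biUnion_insert, hunion _ _ (hA j) (hfin F) ?_, ih,
              Finset.sum_insert hj]
            refine Set.disjoint_iUnion₂_right.2 fun i hi => hdis ?_
            rintro rfl
            exact hj hi
        have htot : ∀ F : Finset ℕ,
            χ (⋃ i, A i) = ∑ i ∈ F, χ (A i) + χ (⋃ i : {i // i ∉ F}, A i) := by
          intro F
          rw [← hsum, ← hunion _ _ (hfin F) (hco F)]
          · congr 1
            ext x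
            simp only [Set.mem_iUnion, Set.mem_union]
            constructor
            · rintro ⟨i, hi⟩
              by_cases hF : i ∈ F
              · exact Or.inl ⟨i, hF, hi⟩
              · exact Or.inr ⟨⟨i, hF⟩, hi⟩
            · rintro (⟨i, _, hi⟩ | ⟨i, hi⟩)
              · exact ⟨i, hi⟩
              · exact ⟨i, hi⟩
          · refine Set.disjoint_iUnion₂_left.2 fun i hi => Set.disjoint_iUnion_right.2 fun j =>
              hdis ?_
            rintro rfl
            exact j.2 hi
        -- The remainder has measure at most the tail of a convergent series. By the bound `C |A ∩
        -- S|^(1/r)` on the norm of `χ A`, its image under `L` tends to 0, which is countable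
        -- additivity.
        have hvol : Tendsto (fun F : Finset ℕ => volume ((⋃ i : {i // i ∉ F}, A i) ∩ S)) atTop
            (𝓝 0) := by
          have h1 : ∑' i, volume (A i ∩ S) ≠ ∞ := by
            rw [← measure_iUnion (fun i j hij => (hdis hij).mono Set.inter_subset_left
              Set.inter_subset_left) fun i => (hA i).inter hS]
            exact (hSb.subset (Set.iUnion_subset fun i => Set.inter_subset_right)).measure_lt_top.ne
          refine tendsto_of_tendsto_of_tendsto_of_le_of_le tendsto_const_nhds
            (ENNReal.tendsto_tsum_compl_atTop_zero h1) (fun _ => zero_le) fun F => ?_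
          rw [Set.iUnion_inter]
          exact measure_iUnion_le _
        have hnorm : Tendsto (fun F : Finset ℕ => L (χ (⋃ i : {i // i ∉ F}, A i))) atTop
            (𝓝 0) := by
          have h2 := (ENNReal.continuous_rpow_const (y := 1 / r)).continuousAt.tendsto.comp hvol
          rw [ENNReal.zero_rpow_of_pos (by positivity)] at h2
          have h3 := ENNReal.Tendsto.const_mul (a := besselCap n α s S ^ (1 / p))
            (ENNReal.Tendsto.const_mul (a := indicatorConst r q) h2
              (Or.inr (indicatorConst_ne_top hq)))
            (Or.inr (ENNReal.rpow_ne_top_of_nonneg (by positivity) (besselCap_lt_top hα hs hSb).ne))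
          rw [mul_zero, mul_zero] at h3
          have h4 := ((ENNReal.continuousAt_toReal ENNReal.zero_ne_top).tendsto.comp h3).const_mul
            ‖L‖
          rw [ENNReal.toReal_zero, mul_zero] at h4
          refine squeeze_zero_norm (fun F => (L.le_opNorm _).trans ?_) h4
          exact mul_le_mul_of_nonneg_left (hχ _ (hco F)).2 (norm_nonneg L)
        simp only [if_pos (hA _), if_pos (MeasurableSet.iUnion hA)]
        have h5 : ∀ F : Finset ℕ, ∑ i ∈ F, L (χ (A i)) =
            L (χ (⋃ i, A i)) - L (χ (⋃ i : {i // i ∉ F}, A i)) := fun F => by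
          rw [htot F, map_add, map_sum, add_sub_cancel_right]
        have h6 := hnorm.const_sub (L (χ (⋃ i, A i)))
        rw [sub_zero] at h6
        exact h6.congr fun F => (h5 F).symm }
  have hν : ∀ A, MeasurableSet A → ν A = L (χ A) := fun A hA => if_pos hA
  -- Indicators of null sets are zero in the block space.
  have hac : ν ≪ᵥ (volume : Measure (Rn n)).toENNRealVectorMeasure :=
    VectorMeasure.AbsolutelyContinuous.mk fun A hA h0 => by
      rw [Measure.toENNRealVectorMeasure_apply_measurable hA] at h0
      rw [hν A hA, hzero A hA h0, map_zero]
  have hrn := SignedMeasure.withDensityᵥ_rnDeriv_eq ν volume hac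
  have hint := SignedMeasure.integrable_rnDeriv ν volume
  refine ⟨ν.rnDeriv volume, SignedMeasure.measurable_rnDeriv ν volume, hint,
    fun A hAS hA g hg => ?_⟩
  rw [← withDensityᵥ_apply hint hA, hrn, hν A hA]
  congr 1
  refine BlockSpace.eq_of_ae (hg.trans ?_)
  have := (hχ A hA).1.symm
  rwa [Set.inter_eq_left.2 hAS] at this

theorem exists_representsIndicators {n : ℕ} {α s p r q : ℝ} (hα : 0 < α) (hs : 1 < s)
    (hpr : p.HolderConjugate r) (hq : 0 < q) (L : StrongDual ℝ (BlockSpace n α s r q)) :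
    ∃ f : Rn n → ℝ, Measurable f ∧ RepresentsIndicators L f := by
  have hfl : Measurable fun x : Rn n => ⌊‖x‖⌋₊ := Nat.measurable_floor.comp measurable_norm
  have hSm : ∀ k : ℕ, MeasurableSet {x : Rn n | ⌊‖x‖⌋₊ = k} := fun k =>
    hfl (measurableSet_singleton k)
  have hSb : ∀ k : ℕ, Bornology.IsBounded {x : Rn n | ⌊‖x‖⌋₊ = k} := fun k => by
    refine (Metric.isBounded_ball (x := (0 : Rn n)) (r := k + 1)).subset fun x hx => ?_
    rw [mem_ball_zero_iff]
    have := Nat.lt_floor_add_one ‖x‖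
    rwa [show ⌊‖x‖⌋₊ = k from hx] at this
  choose F hFm hFi hFL using fun k => exists_setIntegral_eq hα hs hpr hq L (hSm k) (hSb k)
  -- Local densities are glued over the shells `k ≤ ‖x‖ < k + 1`. A bounded set meets finitely many
  -- of them, so the proof is by induction on their number.
  set f : Rn n → ℝ := fun x => F ⌊‖x‖⌋₊ x with hf
  have hfm : Measurable f :=
    (measurable_from_prod_countable_right (f := fun z : ℕ × Rn n => F z.1 z.2) hFm).comp
      (hfl.prodMk measurable_id)
  refine ⟨f, hfm, ?_⟩
  have key : ∀ N : ℕ, ∀ A : Set (Rn n), MeasurableSet A → Bornology.IsBounded A →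
      (∀ x ∈ A, ⌊‖x‖⌋₊ < N) → IntegrableOn f A ∧ ∀ g : BlockSpace n α s r q,
      g.toFun =ᵐ[volume] A.indicator (fun _ => (1 : ℝ)) → L g = ∫ x in A, f x := by
    intro N
    induction N with
    | zero =>
      intro A _ _ hAN
      obtain rfl : A = ∅ := Set.eq_empty_of_forall_notMem fun x hx => Nat.not_lt_zero _ (hAN x hx)
      refine ⟨integrableOn_empty, fun g hg => ?_⟩
      rw [Set.indicator_empty] at hg
      rw [BlockSpace.eq_of_ae (hg.trans BlockSpace.zero_ae.symm), map_zero, setIntegral_empty]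
    | succ N ih =>
      intro A hA hAb hAN
      set B := A ∩ {x | ⌊‖x‖⌋₊ < N} with hB
      set C := A ∩ {x | ⌊‖x‖⌋₊ = N} with hC
      have hBm : MeasurableSet B := hA.inter (hfl measurableSet_Iio)
      have hCm : MeasurableSet C := hA.inter (hSm N)
      have hABC : A = B ∪ C := by
        rw [hB, hC, ← Set.inter_union_distrib_left]
        refine (Set.inter_eq_left.2 fun x hx => ?_).symm
        exact Nat.lt_succ_iff_lt_or_eq.1 (hAN x hx)
      have hdis : Disjoint B C := Set.disjoint_left.2 fun x h1 h2 => by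
        have h3 : ⌊‖x‖⌋₊ < N := h1.2
        exact h3.ne h2.2
      have hBb := hAb.subset (show B ⊆ A from Set.inter_subset_left)
      have hCb := hAb.subset (show C ⊆ A from Set.inter_subset_left)
      obtain ⟨hBi, hBL⟩ := ih B hBm hBb fun x hx => hx.2
      have hfF : Set.EqOn (F N) f C := fun x hx => by
        simp only [hf, show ⌊‖x‖⌋₊ = N from hx.2]
      have hCi : IntegrableOn f C := (hFi N).integrableOn.congr_fun hfF hCm
      refine ⟨hABC ▸ hBi.union hCi, fun g hg => ?_⟩
      obtain ⟨u, hu, -⟩ := BlockSpace.exists_indicator (α := α) (s := s) hα hs hpr hq hBm hBb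
        subset_rfl
      obtain ⟨v, hv, -⟩ := BlockSpace.exists_indicator (α := α) (s := s) hα hs hpr hq hCm hCb
        subset_rfl
      have hguv : g = u + v := by
        refine BlockSpace.eq_of_ae (hg.trans (EventuallyEq.trans ?_ (BlockSpace.add_ae hu hv).symm))
        rw [hABC, Set.indicator_union_of_disjoint hdis]
      rw [hguv, map_add, hBL u hu, hFL N C Set.inter_subset_right hCm v hv,
        setIntegral_congr_fun hCm hfF, hABC, setIntegral_union hdis hCm hBi hCi]
  intro A hA hAb
  obtain ⟨R, hR⟩ := hAb.subset_ball 0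
  refine key (⌊R⌋₊ + 1) A hA hAb fun x hx => Nat.lt_succ_of_le (Nat.floor_mono ?_)
  exact (mem_ball_zero_iff.1 (hR hx)).le

/-! ### Duality -/

theorem weakMultiplierNorm_congr {n : ℕ} {α s p : ℝ} {f g : Rn n → ℝ} (h : f =ᵐ[volume] g) :
    weakMultiplierNorm n α s p f = weakMultiplierNorm n α s p g := by
  have h1 : ∀ (K : Set (Rn n)) (t : ℝ), volume {x | t < |K.indicator f x|} =
      volume {x | t < |K.indicator g x|} := fun K t => by
    refine measure_congr ?_
    filter_upwards [h] with x hx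
    change (t < |K.indicator f x|) = (t < |K.indicator g x|)
    simp only [Set.indicator, hx]
  simp only [weakMultiplierNorm, weakLorentzNorm, h1]

/-- Gives uniqueness. The set `{f ≠ 0}` is exhausted by the sets `{|f| > 1/(m+1)}` inside balls of
radius `k`, each of them null. -/
theorem ae_eq_zero_of_weakMultiplierNorm_eq_zero {n : ℕ} {α s p : ℝ} (hα : 0 < α) (hs : 1 < s)
    (hp : 0 < p) {f : Rn n → ℝ} (hf : Measurable f) (h : weakMultiplierNorm n α s p f = 0) :
    f =ᵐ[volume] fun _ => 0 := by
  have h1 : ∀ k m : ℕ, volume (Metric.ball (0 : Rn n) k ∩ {x | 1 / ((m : ℝ) + 1) < |f x|}) = 0 := by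
    intro k m
    have hpos : (0 : ℝ) < 1 / ((m : ℝ) + 1) := by positivity
    have h2 := mul_volume_rpow_le_weakMultiplierNorm (α := α) (s := s) hα hs hp hf
      (Metric.isOpen_ball (x := (0 : Rn n)) (ε := k)).measurableSet.nullMeasurableSet subset_rfl
      hpos
    rw [h, zero_mul, le_zero_iff, mul_eq_zero] at h2
    rcases h2 with h2 | h2
    · exact absurd (ENNReal.ofReal_eq_zero.1 h2) (not_le.2 hpos)
    · exact (ENNReal.rpow_eq_zero_iff_of_pos (by positivity)).1 h2
  have h3 := measure_iUnion_null fun k => measure_iUnion_null (h1 k)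
  refine measure_mono_null (fun x hx => ?_) h3
  obtain ⟨k, hk⟩ := exists_nat_gt ‖x‖
  obtain ⟨m, hm⟩ := exists_nat_one_div_lt (abs_pos.2 (show f x ≠ 0 from hx))
  exact Set.mem_iUnion.2 ⟨k, Set.mem_iUnion.2 ⟨m, mem_ball_zero_iff.2 hk, hm⟩⟩

theorem exists_mem_weakMultiplierSpace_isRepresentedBy {n : ℕ} {α s p r q : ℝ} (hα : 0 < α)
    (hs : 1 < s) (hpr : p.HolderConjugate r) (hq : 0 < q) (hq1 : q ≤ 1)
    (L : StrongDual ℝ (BlockSpace n α s r q)) :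
    ∃ f ∈ weakMultiplierSpace n α s p, IsRepresentedBy L f := by
  obtain ⟨f₀, hf₀, hrep⟩ := exists_representsIndicators hα hs hpr hq L
  have hae := AEEqFun.coeFn_mk (μ := volume) f₀ hf₀.aestronglyMeasurable
  set f : Rn n →ₘ[volume] ℝ := AEEqFun.mk f₀ hf₀.aestronglyMeasurable with hf
  have hfM : f ∈ weakMultiplierSpace n α s p := by
    change weakMultiplierNorm n α s p f < ∞
    rw [weakMultiplierNorm_congr hae]
    exact (hrep.weakMultiplierNorm_le hα hs hpr hq hf₀).trans_lt
      (ENNReal.mul_lt_top (indicatorConst_ne_top hq).lt_top ENNReal.ofReal_lt_top)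
  -- So far `f` represents `L` only on indicators. It also defines a functional `M` on the whole
  -- block space, and `L - M` vanishes on indicators.
  obtain ⟨M, hM⟩ := exists_isRepresentedBy hα hs hpr hq hq1 hfM
  have hMi := hM.representsIndicators hα hs hpr hq
  have hLM : ∀ g, (L - M) g = 0 := strongDual_eq_zero hα hs hpr hq _ fun A hA hAb g hg => by
    rw [sub_apply, (hrep A hA hAb).2 g hg, (hMi A hA hAb).2 g hg, sub_eq_zero]
    exact (integral_congr_ae (ae_restrict_of_ae hae)).symm
  refine ⟨f, hfM, fun g => ⟨(hM g).1, ?_⟩⟩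
  have := hLM g
  rw [sub_apply, sub_eq_zero] at this
  rw [this, (hM g).2]

theorem IsRepresentedBy.unique {n : ℕ} {α s p r q : ℝ} (hα : 0 < α)
    (hs : 1 < s) (hpr : p.HolderConjugate r) (hq : 0 < q)
    {L : StrongDual ℝ (BlockSpace n α s r q)} {f g : Rn n →ₘ[volume] ℝ}
    (hf : IsRepresentedBy L f) (hg : IsRepresentedBy L g) : f = g := by
  -- The difference represents the zero functional, so the lower bound forces its multiplier norm to
  -- vanish.
  have h0 : IsRepresentedBy (0 : StrongDual ℝ (BlockSpace n α s r q)) (f - g) := fun u => by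
    have hae : (fun x => u.toFun x * (f - g) x) =ᵐ[volume]
        fun x => u.toFun x * f x - u.toFun x * g x := by
      filter_upwards [AEEqFun.coeFn_sub f g] with x hx
      rw [hx, Pi.sub_apply, mul_sub]
    refine ⟨((hf u).1.sub (hg u).1).congr hae.symm, ?_⟩
    rw [integral_congr_ae hae, integral_sub (hf u).1 (hg u).1, ← (hf u).2, ← (hg u).2, sub_self]
    rfl
  have h1 := (h0.representsIndicators hα hs hpr hq).weakMultiplierNorm_le hα hs hpr hq
    (f - g).measurable
  rw [norm_zero, ENNReal.ofReal_zero, mul_zero, le_zero_iff] at h1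
  have h2 := ae_eq_zero_of_weakMultiplierNorm_eq_zero hα hs hpr.pos (f - g).measurable h1
  exact sub_eq_zero.1 (AEEqFun.ext (h2.trans AEEqFun.coeFn_zero.symm))

theorem IsRepresentedBy.toReal_weakMultiplierNorm_le {n : ℕ} {α s p r q : ℝ} (hα : 0 < α)
    (hs : 1 < s) (hpr : p.HolderConjugate r) (hq : 0 < q)
    {L : StrongDual ℝ (BlockSpace n α s r q)} {f : Rn n →ₘ[volume] ℝ} (h : IsRepresentedBy L f) :
    (weakMultiplierNorm n α s p f).toReal ≤ (indicatorConst r q).toReal * ‖L‖ := by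
  have h1 := ENNReal.toReal_mono
    (ENNReal.mul_ne_top (indicatorConst_ne_top hq) ENNReal.ofReal_ne_top)
    ((h.representsIndicators hα hs hpr hq).weakMultiplierNorm_le hα hs hpr hq f.measurable)
  rwa [ENNReal.toReal_mul, ENNReal.toReal_ofReal (norm_nonneg _)] at h1

end SobolevMultiplier

theorem theorem1p8 (n : ℕ) (α s : ℝ) (hα : 0 < α) (hs : 1 < s) (hsn : s ≤ n / α)
    (p q : ℝ) (hp : 1 < p) (hq : 0 < q) (hq1 : q ≤ 1) :
    ∃ c : ℝ, 0 < c ∧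
      (∀ L : StrongDual ℝ (SobolevMultiplier.BlockSpace n α s (Real.conjExponent p) q),
        ∃! f : SobolevMultiplier.Rn n →ₘ[volume] ℝ,
          f ∈ SobolevMultiplier.weakMultiplierSpace n α s p ∧
            SobolevMultiplier.IsRepresentedBy L f) ∧
      (∀ f ∈ SobolevMultiplier.weakMultiplierSpace n α s p,
        ∃ L : StrongDual ℝ (SobolevMultiplier.BlockSpace n α s (Real.conjExponent p) q),
          SobolevMultiplier.IsRepresentedBy L f) ∧
      (∀ L : StrongDual ℝ (SobolevMultiplier.BlockSpace n α s (Real.conjExponent p) q),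
        ∀ f ∈ SobolevMultiplier.weakMultiplierSpace n α s p,
          SobolevMultiplier.IsRepresentedBy L f →
            c⁻¹ * (SobolevMultiplier.weakMultiplierNorm n α s p f).toReal ≤ ‖L‖ ∧
              ‖L‖ ≤ c * (SobolevMultiplier.weakMultiplierNorm n α s p f).toReal) := by
  open SobolevMultiplier in
  have hpr := Real.HolderConjugate.conjExponent hp
  set r := Real.conjExponent p
  have h1 : (0 : ℝ) ≤ (indicatorConst r q).toReal := ENNReal.toReal_nonneg
  have h2 : (0 : ℝ) ≤ (pairingConst r q).toReal := ENNReal.toReal_nonneg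
  -- The sum dominates the constants of both inequalities; the added 1 makes positivity immediate.
  have hc : 0 < (indicatorConst r q).toReal + (pairingConst r q).toReal + 1 := by positivity
  refine ⟨(indicatorConst r q).toReal + (pairingConst r q).toReal + 1, hc, fun L => ?_,
    fun f hf => exists_isRepresentedBy hα hs hpr hq hq1 hf, fun L f hf hL => ⟨?_, ?_⟩⟩
  · obtain ⟨f, hf, hL⟩ := exists_mem_weakMultiplierSpace_isRepresentedBy hα hs hpr hq hq1 L
    exact ⟨f, ⟨hf, hL⟩, fun g hg => hg.2.unique hα hs hpr hq hL⟩
  · rw [inv_mul_le_iff₀ hc]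
    refine (hL.toReal_weakMultiplierNorm_le hα hs hpr hq).trans ?_
    gcongr
    linarith
  · refine (hL.norm_le hα hs hpr hq hq1 hf).trans ?_
    gcongr
    linarith
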